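/- Let $\Xi\subset\mathbb{R}^r$ be convex with nonempty interior, let $f:\mathbb{R}^n\times\Xi\to\mathbb{R}$ and $g=(g_1,\dots,g_m):\mathbb{R}^n\times\Xi\to\mathbb{R}^m$ be twice continuously differentiable in $(x,\xi)$, and consider for $\xi\in\Xi$ the problem $$\min_{x\in\mathbb{R}^n} f(x,\xi)\quad\text{subject to}\quad g(x,\xi)\le 0 .$$ Let $\mathcal{X}(\xi)=\{x: g(x,\xi)\le 0\}$, let $\mathbf{I}_x^\xi=\{i: g_i(x,\xi)=0\}$ be the set of active constraints at $x\in\mathcal X(\xi)$, and let $L(x,\mu,\xi)=f(x,\xi)+\mu^\top g(x,\xi)$. A pair $(x,\mu)\in\mathcal{X}(\xi)\times\mathbb{R}^m_{\ge0}$ is a KKT point for $\xi$ if $\nabla_xL(x,\mu,\xi)=0$ and $\mu_i=0$ whenever $g_i(x,\xi)<0$. Norms are Euclidean norms and the induced operator norms. Assume: 1. $\mathcal{X}(\xi)\neq\emptyset$ for every $\xi\in\Xi$. 2. There are $\alpha>0$, $\beta\ge 0$ and $\ell_1,\dots,\ell_m\ge 0$ such that for every $\xi\in\Xi$ the function $f(\cdot,\xi)$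 is $\alpha$-strongly convex with $\beta$-Lipschitz gradient, and each $g_i(\cdot,\xi)$ is convex with $\ell_i$-Lipschitz gradient. 3. There is $\omega>0$ such that $\omega^2\mathbb{I}\preceq \nabla_xg_{\mathbf{I}_x^\xi}(x,\xi)\,\nabla_xg_{\mathbf{I}_x^\xi}(x,\xi)^\top$ for all $\xi\in\Xi$ and all $x\in\mathcal{X}(\xi)$ with $\mathbf{I}_x^\xi\ne\emptyset$, where $\nabla_xg_{\mathbf{I}}$ is the Jacobian in $x$ of $(g_i)_{i\in\mathbf{I}}$. 4. There are $\zeta_1,\dots,\zeta_m>0$ such that for every $\xi\in\Xi$ every KKT point $(x,\mu)$ for $\xi$ satisfies $\mu_i\le\zeta_i$ for all $i$. Then for every $\xi\in\Xi$ the problem has exactly one minimizer $x^\star(\xi)$, and there is exactly one $\mu^\star(\xi)$ for which $(x^\star(\xi),\mu^\star(\xi))$ is a KKT point. Moreover, put $$\bar L^\star=\sup_{\xi\in\Xi}\bigl\|\nabla^2_{\xi x}L(x^\star(\xi),\mu^\star(\xi),\xi)\bigr\|,\qquad \bar G^\star=\sup_{\xi\in\Xi}\bigl\|\nabla_\xi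 g_{\mathbf{I}^\star(\xi)}(x^\star(\xi),\xi)\bigr\|,\qquad \mathbf{I}^\star(\xi)=\mathbf{I}^\xi_{x^\star(\xi)},$$ where $\nabla^2_{\xi x}L=\nabla_\xi(\nabla_xL)$ is taken with $x,\mu$ fixed, and the second norm is $0$ when $\mathbf{I}^\star(\xi)=\emptyset$. If both suprema are finite, then $x^\star:\Xi\to\mathbb{R}^n$ and $\mu^\star:\Xi\to\mathbb{R}^m$ are Lipschitz continuous on $\Xi$ with respective Lipschitz constants $$\ell_{x^\star}=\sqrt{\frac{\beta+\sum_i\zeta_i\ell_i}{\alpha}}\left(\frac{\bar L^\star}{\alpha}+\frac{\bar G^\star}{\omega}\right),\qquad \ell_{\mu^\star}=\frac{(\beta+\sum_i\zeta_i\ell_i)^{3/2}}{\alpha^{1/2}\,\omega}\left(\frac{\bar L^\star}{\alpha}+\frac{\bar G^\star}{\omega}\right).$$ -/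

import Mathlib

open Set
open scoped NNReal

noncomputable section

/-- `ℝⁿ` with the Euclidean inner product and norm. -/
abbrev Euc (n : ℕ) : Type := EuclideanSpace ℝ (Fin n)

namespace ParamProgram

/-! The program: minimize `f x ξ` over `x ∈ ℝⁿ` subject to `g x ξ ≤ 0` (componentwise in `ℝᵐ`),
with a parameter `ξ ∈ ℝʳ`. -/

/-- The feasible set at the parameter `ξ`. -/
def feasible {n m r : ℕ} (g : Euc n → Euc r → Euc m) (ξ : Euc r) : Set (Euc n) :=
  {x | ∀ i, g x ξ i ≤ 0}

/-- The type of indices of the constraints active at `x` for the parameter `ξ`. -/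
abbrev Active {n m r : ℕ} (g : Euc n → Euc r → Euc m) (x : Euc n) (ξ : Euc r) : Type :=
  {i : Fin m // g x ξ i = 0}

/-- The Lagrangian `f(x, ξ) + μᵀ g(x, ξ)`. -/
def lagrangian {n m r : ℕ} (f : Euc n → Euc r → ℝ) (g : Euc n → Euc r → Euc m)
    (x : Euc n) (μ : Euc m) (ξ : Euc r) : ℝ :=
  f x ξ + ∑ i, μ i * g x ξ i

/-- The Karush-Kuhn-Tucker conditions at `(x, μ)` for the parameter `ξ`. -/
structure IsKKT {n m r : ℕ} (f : Euc n → Euc r → ℝ) (g : Euc n → Euc r → Euc m)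
    (ξ : Euc r) (x : Euc n) (μ : Euc m) : Prop where
  feasible : x ∈ feasible g ξ
  nonneg : ∀ i, 0 ≤ μ i
  stationary : gradient (fun y => lagrangian f g y μ ξ) x = 0
  slack : ∀ i, g x ξ i < 0 → μ i = 0

/-- The (set-valued) primal solution map: the global minimizers at the parameter `ξ`. -/
def primalSolutions {n m r : ℕ} (f : Euc n → Euc r → ℝ) (g : Euc n → Euc r → Euc m)
    (ξ : Euc r) : Set (Euc n) :=
  {x | x ∈ feasible g ξ ∧ IsMinOn (fun y => f y ξ) (feasible g ξ) x}

/-- The (set-valued) dual solution map: the multipliers which, together with some primal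
solution, satisfy the KKT conditions at the parameter `ξ`. -/
def dualSolutions {n m r : ℕ} (f : Euc n → Euc r → ℝ) (g : Euc n → Euc r → Euc m)
    (ξ : Euc r) : Set (Euc m) :=
  {μ | ∃ x ∈ primalSolutions f g ξ, IsKKT f g ξ x μ}

/-- The Jacobian in `x` of the constraints active at `(x, ξ)`; its rows are their gradients. -/
def activeJacobian {n m r : ℕ} (g : Euc n → Euc r → Euc m) (x : Euc n) (ξ : Euc r) :
    Matrix (Active g x ξ) (Fin n) ℝ :=
  Matrix.of fun i j => gradient (fun y => g y ξ i.1) x j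

/-- Uniform LICQ with constant `ω`: `ω² 𝕀 ⪯ J Jᵀ` for the active Jacobian `J` at every feasible
point with at least one active constraint, for every parameter in `Ξ`. -/
def UniformLICQ {n m r : ℕ} (g : Euc n → Euc r → Euc m) (Ξ : Set (Euc r)) (ω : ℝ) : Prop :=
  ∀ ξ ∈ Ξ, ∀ x ∈ feasible g ξ, Nonempty (Active g x ξ) →
    (activeJacobian g x ξ * (activeJacobian g x ξ).transpose
      - (ω ^ 2) • (1 : Matrix (Active g x ξ) (Active g x ξ) ℝ)).PosSemidef

/-- The mixed second derivative `∇²_{ξx} L(x, μ, ξ)`, i.e. the derivative in `ξ` (on `Ξ`) of the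
gradient in `x` of the Lagrangian, as a linear map `ℝʳ → ℝⁿ`. -/
def mixedHessian {n m r : ℕ} (f : Euc n → Euc r → ℝ) (g : Euc n → Euc r → Euc m)
    (Ξ : Set (Euc r)) (x : Euc n) (μ : Euc m) (ξ : Euc r) : Euc r →L[ℝ] Euc n :=
  fderivWithin ℝ (fun η => gradient (fun y => lagrangian f g y μ η) x) Ξ ξ

/-- The derivative in `ξ` (on `Ξ`) of the constraints active at `(x, ξ)`, as a linear map into
the Euclidean space indexed by the active constraints (the zero map if there are none). -/
def activeParamDeriv {n m r : ℕ} (g : Euc n → Euc r → Euc m)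
    (Ξ : Set (Euc r)) (x : Euc n) (ξ : Euc r) :
    Euc r →L[ℝ] EuclideanSpace ℝ (Active g x ξ) :=
  fderivWithin ℝ (fun η => WithLp.toLp 2 fun i : Active g x ξ => g x η i.1) Ξ ξ

end ParamProgram

end

/-!
Near a KKT point `(x₀, μ₀)` at `ξ₀`, inactive constraints keep zero multipliers, so the differences
`x - x₀` and `μ - μ₀` satisfy `H (x - x₀) + p = a` with `H` the Hessian of the Lagrangian,
`p = D† (μ - μ₀)` and `‖a‖` controlled to first order by the mixed Hessian. Complementarity at both
points gives `0 ≤ ⟪p, x - x₀ - d⟫` for the least-norm `d` that reproduces the linearised active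
constraints, and LICQ bounds `d`. Writing `H = S† S`, this inequality confines `S (x - x₀)` to a
ball of Thales type; since `α ≤ H ≤ B`, leaving the energy norm costs exactly the factor `√(B / α)`.

This bounds the local growth of the solution maps at each parameter, and integration along segments
of the convex set `Ξ` gives the global Lipschitz estimate. The continuity of `x⋆` needed to start
comes from the strong convexity of the Lagrangian and the uniform bound on multipliers.
-/

open Filter Topology InnerProductSpace

theorem le_div_add_sqrt_of_mul_sq_le {a b c t : ℝ} (ha : 0 < a) (hb : 0 ≤ b)
    (h : a * t ^ 2 ≤ b * t + c) : t ≤ b / a + √(c / a) := by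
  by_contra! hlt
  have hs := Real.sqrt_nonneg (c / a)
  have hc : c ≤ a * √(c / a) ^ 2 := by
    rw [← div_le_iff₀' ha, ← Real.sqrt_le_left hs]
  have hmul : b + a * √(c / a) < a * t := by
    have := mul_lt_mul_of_pos_left hlt ha
    rwa [mul_add, mul_div_cancel₀ _ ha.ne'] at this
  have hst : √(c / a) < t := lt_of_le_of_lt (le_add_of_nonneg_left (by positivity)) hlt
  nlinarith

theorem rpow_three_halves_div {B α ω : ℝ} (hB : 0 ≤ B) :
    B ^ (3 / 2 : ℝ) / (α ^ (1 / 2 : ℝ) * ω) = B / ω * √(B / α) := by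
  rw [Real.sqrt_div hB, Real.sqrt_eq_rpow, Real.sqrt_eq_rpow,
    show (3 / 2 : ℝ) = 1 + 1 / 2 by norm_num, Real.rpow_add' hB (by norm_num), Real.rpow_one]
  ring

theorem exists_gt_mul_le_of_mul_lt {c K C : ℝ} (h : c * K < C) : ∃ K' > K, c * K' ≤ C := by
  have hlim : Tendsto (fun t => c * t) (𝓝[>] K) (𝓝 (c * K)) :=
    ((continuous_const_mul c).tendsto K).mono_left nhdsWithin_le_nhds
  obtain ⟨K', hK', hlt⟩ := ((eventually_mem_nhdsWithin (s := Ioi K)).and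
    (hlim.eventually_lt_const h)).exists
  exact ⟨K', hK', hlt.le⟩

theorem norm_le_opNorm_mul_add_norm_add_apply {V W : Type*} [SeminormedAddCommGroup V]
    [NormedSpace ℝ V] [SeminormedAddCommGroup W] [NormedSpace ℝ W] (b : W) (M : V →L[ℝ] W) (v : V) :
    ‖b‖ ≤ ‖M‖ * ‖v‖ + ‖b + M v‖ := by
  have htri := norm_sub_le (b + M v) (M v)
  rw [add_sub_cancel_right] at htri
  linarith [M.le_opNorm v]

theorem norm_le_norm_of_forall_apply_le {ι : Type*} [Fintype ι] {a b : EuclideanSpace ℝ ι}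
    (ha : ∀ i, 0 ≤ a i) (hab : ∀ i, a i ≤ b i) : ‖a‖ ≤ ‖b‖ := by
  rw [EuclideanSpace.norm_eq, EuclideanSpace.norm_eq]
  refine Real.sqrt_le_sqrt (Finset.sum_le_sum fun i _ => pow_le_pow_left₀ (norm_nonneg _) ?_ 2)
  rw [Real.norm_of_nonneg (ha i), Real.norm_of_nonneg ((ha i).trans (hab i))]
  exact hab i

section StrongConvexity

variable {E : Type*} [NormedAddCommGroup E] [InnerProductSpace ℝ E] [CompleteSpace E]
  {φ : E → ℝ} {α : ℝ}

theorem strongConvexOn_add_inner_add_le (hφ : StrongConvexOn univ α φ) {x v : E}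
    (hv : HasGradientAt φ v x) (y : E) :
    φ x + ⟪v, y - x⟫_ℝ + α / 2 * ‖y - x‖ ^ 2 ≤ φ y := by
  have hslope : Tendsto (fun t : ℝ => t⁻¹ • (φ (x + t • (y - x)) - φ x)) (𝓝[>] 0)
      (𝓝 ⟪v, y - x⟫_ℝ) := by
    simpa using (hv.hasFDerivAt.hasLineDerivAt (y - x)).tendsto_slope_zero_right
  have hbound : Tendsto (fun t : ℝ => φ y - φ x - (1 - t) * (α / 2 * ‖y - x‖ ^ 2)) (𝓝[>] 0)
      (𝓝 (φ y - φ x - (1 - 0) * (α / 2 * ‖y - x‖ ^ 2))) :=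
    (Continuous.tendsto (by fun_prop) 0).mono_left nhdsWithin_le_nhds
  have hle : ∀ᶠ t : ℝ in 𝓝[>] 0, t⁻¹ • (φ (x + t • (y - x)) - φ x)
      ≤ φ y - φ x - (1 - t) * (α / 2 * ‖y - x‖ ^ 2) := by
    filter_upwards [Ioo_mem_nhdsGT (zero_lt_one' ℝ)] with t ht
    have hconv := hφ.2 (mem_univ x) (mem_univ y) (sub_nonneg.2 ht.2.le) ht.1.le (by ring)
    rw [show (1 - t) • x + t • y = x + t • (y - x) by module, norm_sub_rev x y] at hconv
    simp only [smul_eq_mul] at hconv ⊢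
    rw [inv_mul_le_iff₀ ht.1]
    linarith
  linarith [le_of_tendsto_of_tendsto hslope hbound hle]

theorem mul_norm_sub_sq_le_inner_gradient_sub (hφ : StrongConvexOn univ α φ) {x y v w : E}
    (hv : HasGradientAt φ v x) (hw : HasGradientAt φ w y) :
    α * ‖y - x‖ ^ 2 ≤ ⟪w - v, y - x⟫_ℝ := by
  have hxy := strongConvexOn_add_inner_add_le hφ hv y
  have hyx := strongConvexOn_add_inner_add_le hφ hw x
  rw [norm_sub_rev x y, ← neg_sub y x, inner_neg_right] at hyx
  rw [inner_sub_left]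
  linarith

theorem mul_norm_sq_le_inner_hessian {Φ : E → E} {H : E →L[ℝ] E} {x : E}
    (hφ : StrongConvexOn univ α φ) (hΦ : ∀ y, HasGradientAt φ (Φ y) y)
    (hH : HasFDerivAt Φ H x) (v : E) : α * ‖v‖ ^ 2 ≤ ⟪H v, v⟫_ℝ := by
  have hslope : Tendsto (fun t : ℝ => ⟪t⁻¹ • (Φ (x + t • v) - Φ x), v⟫_ℝ) (𝓝[>] 0)
      (𝓝 ⟪H v, v⟫_ℝ) :=
    (hH.hasLineDerivAt v).tendsto_slope_zero_right.inner tendsto_const_nhds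
  refine ge_of_tendsto hslope ?_
  filter_upwards [self_mem_nhdsWithin] with t (ht : 0 < t)
  have hmono := mul_norm_sub_sq_le_inner_gradient_sub hφ (hΦ x) (hΦ (x + t • v))
  rw [add_sub_cancel_left, norm_smul, inner_smul_right, Real.norm_eq_abs, mul_pow, sq_abs] at hmono
  rw [real_inner_smul_left, le_inv_mul_iff₀ ht]
  exact le_of_mul_le_mul_left (by linarith) ht

theorem inner_hessian_left_eq_right {Φ : E → E} {H : E →L[ℝ] E} {x : E}
    (hΦ : ∀ y, HasGradientAt φ (Φ y) y) (hH : HasFDerivAt Φ H x) (v w : E) :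
    ⟪H v, w⟫_ℝ = ⟪v, H w⟫_ℝ := by
  let S : E →L[ℝ] E →L[ℝ] ℝ := innerSL ℝ
  have hφ : ∀ y, HasFDerivAt φ (S (Φ y)) y := fun y => (hΦ y).hasFDerivAt
  have hSΦ : HasFDerivAt (fun y => S (Φ y)) (S.comp H) x := S.hasFDerivAt.comp x hH
  have hsymm : ⟪H v, w⟫_ℝ = ⟪H w, v⟫_ℝ := second_derivative_symmetric hφ hSΦ v w
  rw [hsymm, real_inner_comm]

end StrongConvexity

section Existence

variable {E : Type*} [NormedAddCommGroup E] [InnerProductSpace ℝ E] [ProperSpace E]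
  {φ : E → ℝ} {α : ℝ}

theorem strongConvexOn_tendsto_cocompact_atTop (hα : 0 < α)
    (hφ : StrongConvexOn univ α φ) {x v : E} (hv : HasGradientAt φ v x) :
    Tendsto φ (cocompact E) atTop := by
  have hdist : Tendsto (fun y => ‖y - x‖) (cocompact E) atTop := by
    simpa only [dist_eq_norm] using tendsto_dist_right_cocompact_atTop x
  have hquad : Tendsto (fun t : ℝ => φ x + t * (α / 2 * t - ‖v‖)) atTop atTop :=
    tendsto_atTop_add_const_left _ _ <| tendsto_id.atTop_mul_atTop₀ <|
      tendsto_atTop_add_const_right _ _ <| tendsto_id.const_mul_atTop (half_pos hα)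
  refine tendsto_atTop_mono (fun y => ?_) (hquad.comp hdist)
  have hlower := strongConvexOn_add_inner_add_le hφ hv y
  have hinner := neg_le_of_abs_le (abs_real_inner_le_norm v (y - x))
  simp only [Function.comp_apply]
  linarith

theorem exists_isMinOn_of_strongConvexOn (hα : 0 < α)
    (hφ : StrongConvexOn univ α φ) (hd : Differentiable ℝ φ) {s : Set E} (hs : IsClosed s)
    (hne : s.Nonempty) : ∃ x ∈ s, IsMinOn φ s x := by
  obtain ⟨x₀, hx₀⟩ := hne
  have hlarge := (strongConvexOn_tendsto_cocompact_atTop hα hφ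
    (hd x₀).hasGradientAt).eventually_ge_atTop (φ x₀)
  exact hd.continuous.continuousOn.exists_isMinOn' hs hx₀ (hlarge.filter_mono inf_le_left)

end Existence

section Thales

variable {E : Type*} [NormedAddCommGroup E] [InnerProductSpace ℝ E]

theorem norm_add_le_norm_sub_of_inner_nonpos {a b : E} (h : ⟪a, b⟫_ℝ ≤ 0) :
    ‖a + b‖ ≤ ‖a - b‖ := by
  refine le_of_sq_le_sq ?_ (norm_nonneg _)
  rw [norm_add_sq_real, norm_sub_sq_real]
  linarith

/- Thales: `u` lies in the ball with diameter `[q, d]`, whose diameter is at most `‖q‖ + ‖d‖`. -/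
theorem norm_le_of_inner_sub_sub_nonpos {u q d : E} (h : ⟪u - q, u - d⟫_ℝ ≤ 0) :
    ‖u‖ ≤ ‖q‖ + ‖d‖ ∧ ‖u - q‖ ≤ ‖q‖ + ‖d‖ := by
  have hsum : ‖(u - q) + (u - d)‖ ≤ ‖q‖ + ‖d‖ := by
    refine (norm_add_le_norm_sub_of_inner_nonpos h).trans ?_
    rw [sub_sub_sub_cancel_left, add_comm]
    exact norm_sub_le d q
  have half_le {v w : E} (hv : (2 : ℝ) • v = ((u - q) + (u - d)) + w)
      (hw : ‖w‖ ≤ ‖q‖ + ‖d‖) : ‖v‖ ≤ ‖q‖ + ‖d‖ := by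
    have hnorm : 2 * ‖v‖ ≤ ‖(u - q) + (u - d)‖ + ‖w‖ := by
      rw [← Real.norm_ofNat (n := 2), ← norm_smul, hv]
      exact norm_add_le _ w
    linarith
  exact ⟨half_le (w := q + d) (by module) (norm_add_le q d),
    half_le (w := d - q) (by module) ((norm_sub_le d q).trans_eq (add_comm _ _))⟩

end Thales

section BoundedBelow

variable {E F : Type*} [NormedAddCommGroup E] [InnerProductSpace ℝ E] [FiniteDimensional ℝ E]
  [NormedAddCommGroup F] [InnerProductSpace ℝ F] [CompleteSpace F]

theorem exists_adjoint_apply_eq_and_norm_le {T : E →L[ℝ] F} {ω : ℝ} (hω : 0 < ω)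
    (hT : ∀ c, ω * ‖c‖ ≤ ‖T c‖) (b : E) :
    ∃ c, T.adjoint (T c) = b ∧ ‖T c‖ ≤ ‖b‖ / ω := by
  have hinj : Function.Injective T := (injective_iff_map_eq_zero T).2 fun c hc => by
    have := hT c
    rw [hc, norm_zero] at this
    exact norm_le_zero_iff.1 (nonpos_of_mul_nonpos_right this hω)
  obtain ⟨c, hc⟩ : ∃ c, T.adjoint (T c) = b :=
    LinearMap.surjective_of_injective (f := (T.adjoint ∘L T : E →ₗ[ℝ] E))
      (T.adjoint_comp_self_injective_iff.2 hinj) b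
  refine ⟨c, hc, ?_⟩
  have hsq : ‖T c‖ * ‖T c‖ ≤ ‖b‖ * ‖c‖ := by
    rw [← real_inner_self_eq_norm_mul_norm, ← T.adjoint_inner_left, hc]
    exact real_inner_le_norm b c
  rw [le_div_iff₀ hω]
  rcases (norm_nonneg (T c)).eq_or_lt with h0 | hpos
  · simp [← h0]
  · refine le_of_mul_le_mul_right ?_ hpos
    calc ‖T c‖ * ω * ‖T c‖ = ω * (‖T c‖ * ‖T c‖) := by ring
      _ ≤ ω * (‖b‖ * ‖c‖) := by gcongr
      _ = ‖b‖ * (ω * ‖c‖) := by ring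
      _ ≤ ‖b‖ * ‖T c‖ := by gcongr; exact hT c

theorem surjective_of_mul_norm_le_norm_adjoint {S : F →L[ℝ] E} {ω : ℝ} (hω : 0 < ω)
    (hS : ∀ c, ω * ‖c‖ ≤ ‖S.adjoint c‖) : Function.Surjective S := fun b => by
  obtain ⟨c, hc, -⟩ := exists_adjoint_apply_eq_and_norm_le hω hS b
  exact ⟨_, by simpa using hc⟩

end BoundedBelow

section Variational

variable {E : Type*} [NormedAddCommGroup E] [InnerProductSpace ℝ E] [FiniteDimensional ℝ E]

theorem exists_adjoint_comp_self_eq {H : E →L[ℝ] E} (hH : H.IsPositive) :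
    ∃ (k : ℕ) (S : E →L[ℝ] EuclideanSpace ℝ (Fin k)), S.adjoint ∘L S = H := by
  obtain ⟨k, u, rfl⟩ := ContinuousLinearMap.isPositive_iff_eq_sum_rankOne.1 hH
  refine ⟨k, (EuclideanSpace.equiv (Fin k) ℝ).symm.toContinuousLinearMap ∘L
    ContinuousLinearMap.pi fun i => innerSL ℝ (u i), ?_⟩
  ext v
  refine ext_inner_right ℝ fun w => ?_
  rw [ContinuousLinearMap.comp_apply, ContinuousLinearMap.adjoint_inner_left]
  simp [PiLp.inner_apply, sum_inner, real_inner_smul_left, mul_comm]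

theorem norm_le_of_adjoint_apply_add_eq {F : Type*} [NormedAddCommGroup F]
    [InnerProductSpace ℝ F] [CompleteSpace F] {S : E →L[ℝ] F} {s : ℝ} (hs : 0 < s)
    (hS : ∀ v, s * ‖v‖ ≤ ‖S v‖) {x p a d : E} (hx : S.adjoint (S x) + p = a)
    (hp : 0 ≤ ⟪p, x - d⟫_ℝ) :
    s * ‖x‖ ≤ ‖a‖ / s + ‖S‖ * ‖d‖ ∧ ‖p‖ ≤ ‖S‖ * (‖a‖ / s + ‖S‖ * ‖d‖) := by
  obtain ⟨q, hq, hqn⟩ := exists_adjoint_apply_eq_and_norm_le hs hS a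
  have hp_eq : p = -S.adjoint (S x - S q) := by rw [map_sub, hq, ← hx]; abel
  have hobtuse : ⟪S x - S q, S x - S d⟫_ℝ ≤ 0 := by
    rw [← map_sub S x d, ← S.adjoint_inner_left, ← neg_nonneg, ← inner_neg_left, ← hp_eq]
    exact hp
  obtain ⟨hball, hball'⟩ := norm_le_of_inner_sub_sub_nonpos hobtuse
  have hsum : ‖S q‖ + ‖S d‖ ≤ ‖a‖ / s + ‖S‖ * ‖d‖ := add_le_add hqn (S.le_opNorm d)
  refine ⟨(hS x).trans (hball.trans hsum), ?_⟩
  calc ‖p‖ = ‖S.adjoint (S x - S q)‖ := by rw [hp_eq, norm_neg]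
    _ ≤ ‖S.adjoint‖ * ‖S x - S q‖ := S.adjoint.le_opNorm _
    _ ≤ ‖S‖ * (‖a‖ / s + ‖S‖ * ‖d‖) := by
        rw [LinearIsometryEquiv.norm_map]
        gcongr
        exact hball'.trans hsum

theorem norm_le_of_variational {H : E →L[ℝ] E} {α B : ℝ} (hα : 0 < α)
    (hH : (H : E →ₗ[ℝ] E).IsSymmetric) (hcoer : ∀ v, α * ‖v‖ ^ 2 ≤ ⟪H v, v⟫_ℝ) (hB : ‖H‖ ≤ B)
    {x p a d : E} (hx : H x + p = a) (hp : 0 ≤ ⟪p, x - d⟫_ℝ) :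
    ‖x‖ ≤ √(B / α) * (‖a‖ / α + ‖d‖) ∧ ‖p‖ ≤ B * (√(B / α) * (‖a‖ / α + ‖d‖)) := by
  obtain ⟨k, S, rfl⟩ := exists_adjoint_comp_self_eq (H := H) ⟨hH, fun v =>
    (mul_nonneg hα.le (sq_nonneg _)).trans (hcoer v)⟩
  have hB0 : 0 ≤ B := (norm_nonneg _).trans hB
  have hs := Real.sqrt_pos.2 hα
  have hS_le : ‖S‖ ≤ √B := by
    rw [S.norm_adjoint_comp_self] at hB
    exact Real.le_sqrt_of_sq_le (by rwa [sq])
  have hS_ge (v : E) : √α * ‖v‖ ≤ ‖S v‖ := by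
    refine le_of_sq_le_sq ?_ (norm_nonneg _)
    rw [mul_pow, Real.sq_sqrt hα.le, ← real_inner_self_eq_norm_sq (S v), ← S.adjoint_inner_left]
    exact hcoer v
  obtain ⟨hxn, hpn⟩ := norm_le_of_adjoint_apply_add_eq hs hS_ge hx hp
  have hαB (v : E) : √α * ‖v‖ ≤ √B * ‖v‖ := (hS_ge v).trans (S.le_of_opNorm_le hS_le v)
  have hbound : ‖a‖ / √α + ‖S‖ * ‖d‖ ≤ √α * (√(B / α) * (‖a‖ / α + ‖d‖)) := by
    rw [Real.sqrt_div hB0]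
    calc ‖a‖ / √α + ‖S‖ * ‖d‖ = √α * ‖a‖ / √α ^ 2 + ‖S‖ * ‖d‖ := by field_simp
      _ ≤ √B * ‖a‖ / √α ^ 2 + √B * ‖d‖ := by gcongr ?_ / _ + ?_ * _; exact hαB a
      _ = √α * (√B / √α * (‖a‖ / α + ‖d‖)) := by rw [Real.sq_sqrt hα.le]; field_simp
  refine ⟨le_of_mul_le_mul_left (hxn.trans hbound) hs, le_of_mul_le_mul_left ?_ hs⟩
  calc √α * ‖p‖ ≤ √B * ‖p‖ := hαB p
    _ ≤ √B * (√B * (√α * (√(B / α) * (‖a‖ / α + ‖d‖)))) := by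
        gcongr
        exact hpn.trans (mul_le_mul hS_le hbound (by positivity) (by positivity))
    _ = √α * (B * (√(B / α) * (‖a‖ / α + ‖d‖))) := by
        rw [← mul_assoc √B √B, Real.mul_self_sqrt hB0]; ring

end Variational

section Multipliers

variable {E ι : Type*} [NormedAddCommGroup E] [InnerProductSpace ℝ E]

theorem inner_nonneg_of_apply_nonpos {S : E →L[ℝ] EuclideanSpace ℝ ι}
    (hS : Function.Surjective S) {c : E} (hc : ∀ d, (∀ i, S d i < 0) → 0 ≤ ⟪c, d⟫_ℝ)
    {d : E} (hd : ∀ i, S d i ≤ 0) : 0 ≤ ⟪c, d⟫_ℝ := by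
  obtain ⟨s, hs⟩ := hS (WithLp.toLp 2 fun _ => -1)
  have hlim : Tendsto (fun ε : ℝ => ⟪c, d + ε • s⟫_ℝ) (𝓝[>] 0) (𝓝 ⟪c, d⟫_ℝ) := by
    refine Tendsto.mono_left ?_ nhdsWithin_le_nhds
    simpa using (show Continuous fun ε : ℝ => ⟪c, d + ε • s⟫_ℝ by fun_prop).tendsto 0
  refine ge_of_tendsto hlim ?_
  filter_upwards [self_mem_nhdsWithin] with ε (hε : 0 < ε)
  refine hc _ fun i => ?_
  have hdi := hd i
  simp only [map_add, map_smul, hs, PiLp.add_apply, PiLp.smul_apply, smul_eq_mul]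
  linarith

theorem exists_nonneg_add_adjoint_eq_zero [CompleteSpace E] [Fintype ι]
    {S : E →L[ℝ] EuclideanSpace ℝ ι} (hS : Function.Surjective S) {c : E}
    (hc : ∀ d, (∀ i, S d i < 0) → 0 ≤ ⟪c, d⟫_ℝ) :
    ∃ μ : EuclideanSpace ℝ ι, (∀ i, 0 ≤ μ i) ∧ c + S.adjoint μ = 0 := by
  classical
  have hker : c ∈ S.kerᗮ := by
    refine (Submodule.mem_orthogonal' _ _).2 fun d (hSd : S d = 0) => le_antisymm ?_ ?_
    · rw [← neg_nonneg, ← inner_neg_right]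
      exact inner_nonneg_of_apply_nonpos hS hc (by simp [hSd])
    · exact inner_nonneg_of_apply_nonpos hS hc (by simp [hSd])
  obtain ⟨ν, rfl⟩ : ∃ ν, S.adjoint ν = c := by
    rwa [S.orthogonal_ker,
      (Submodule.closed_of_finiteDimensional _).submodule_topologicalClosure_eq] at hker
  refine ⟨-ν, fun i => ?_, by simp⟩
  obtain ⟨d, hd⟩ := hS (-EuclideanSpace.single i 1)
  have hnonneg := inner_nonneg_of_apply_nonpos hS hc (d := d) fun j => by
    by_cases hji : j = i <;> simp [hd, hji]
  simpa [ContinuousLinearMap.adjoint_inner_left, hd, EuclideanSpace.inner_single_right]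
    using hnonneg

end Multipliers

section CoordRestrict

variable {ι : Type*}

/-- The restriction of a vector to its coordinates `i` with `p i`. -/
noncomputable def coordRestrict (p : ι → Prop) :
    EuclideanSpace ℝ ι →L[ℝ] EuclideanSpace ℝ {i // p i} :=
  (EuclideanSpace.equiv {i // p i} ℝ).symm.toContinuousLinearMap ∘L
    ContinuousLinearMap.pi fun i => EuclideanSpace.proj i.1

variable {p : ι → Prop}

@[simp]
theorem coordRestrict_apply (c : EuclideanSpace ℝ ι) (i : {i // p i}) :
    coordRestrict p c i = c i := rfl

theorem coordRestrict_eq_toLp (c : EuclideanSpace ℝ ι) :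
    coordRestrict p c = WithLp.toLp 2 fun i : {i // p i} => c i := rfl

theorem exists_coordRestrict_eq (b : EuclideanSpace ℝ {i // p i}) :
    ∃ c : EuclideanSpace ℝ ι, (∀ i, ¬p i → c i = 0) ∧ coordRestrict p c = b := by
  classical
  exact ⟨WithLp.toLp 2 fun i => if h : p i then b ⟨i, h⟩ else 0, fun i hi => by simp [hi],
    by ext i; simp [i.2]⟩

variable [Fintype ι] [DecidablePred p]

theorem inner_coordRestrict {c : EuclideanSpace ℝ ι} (hc : ∀ i, ¬p i → c i = 0)
    (d : EuclideanSpace ℝ ι) : ⟪coordRestrict p c, coordRestrict p d⟫_ℝ = ⟪c, d⟫_ℝ := by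
  simp only [PiLp.inner_apply, coordRestrict_apply]
  rw [← Finset.sum_subtype (Finset.univ.filter p) (by simp) fun i => ⟪c i, d i⟫_ℝ,
    Finset.sum_filter_of_ne]
  exact fun i _ hi => by_contra fun hpi => hi (by rw [hc i hpi, inner_zero_left])

theorem norm_coordRestrict {c : EuclideanSpace ℝ ι} (hc : ∀ i, ¬p i → c i = 0) :
    ‖coordRestrict p c‖ = ‖c‖ := by
  rw [@norm_eq_sqrt_real_inner, @norm_eq_sqrt_real_inner, inner_coordRestrict hc]

theorem adjoint_comp_coordRestrict {E : Type*} [NormedAddCommGroup E] [InnerProductSpace ℝ E]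
    [CompleteSpace E] (D : E →L[ℝ] EuclideanSpace ℝ ι) {c : EuclideanSpace ℝ ι}
    (hc : ∀ i, ¬p i → c i = 0) :
    (coordRestrict p ∘L D).adjoint (coordRestrict p c) = D.adjoint c := by
  refine ext_inner_right ℝ fun v => ?_
  simp only [ContinuousLinearMap.adjoint_inner_left, ContinuousLinearMap.comp_apply]
  exact inner_coordRestrict hc _

end CoordRestrict

section Gram

variable {ι κ : Type*} [Fintype ι] [Fintype κ] [DecidableEq ι] [DecidableEq κ]

theorem mul_norm_le_norm_adjoint_of_posSemidef {J : Matrix ι κ ℝ} {ω : ℝ}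
    (h : (J * J.transpose - ω ^ 2 • (1 : Matrix ι ι ℝ)).PosSemidef) (c : EuclideanSpace ℝ ι) :
    ω * ‖c‖ ≤ ‖J.toEuclideanLin.adjoint c‖ := by
  refine le_of_sq_le_sq ?_ (norm_nonneg _)
  have hpos := h.dotProduct_mulVec_nonneg c.ofLp
  rw [← sub_nonneg, mul_pow, ← real_inner_self_eq_norm_sq c,
    ← real_inner_self_eq_norm_sq (J.toEuclideanLin.adjoint c),
    LinearMap.adjoint_inner_left, ← Matrix.toEuclideanLin_conjTranspose_eq_adjoint]
  rw [Matrix.sub_mulVec, dotProduct_sub, Matrix.smul_mulVec, Matrix.one_mulVec, dotProduct_smul,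
    star_trivial, ← Matrix.mulVec_mulVec, dotProduct_comm, smul_eq_mul] at hpos
  simpa only [EuclideanSpace.inner_eq_star_dotProduct, star_trivial, Matrix.ofLp_toLpLin,
    Matrix.toLin'_apply, Matrix.conjTranspose_eq_transpose_of_trivial] using hpos

end Gram

section PartialDerivatives

variable {E V W : Type*} [NormedAddCommGroup E] [NormedSpace ℝ E] [NormedAddCommGroup V]
  [NormedSpace ℝ V] [NormedAddCommGroup W] [NormedSpace ℝ W] {Ξ : Set V} {F : E → V → W}

theorem hasFDerivAt_slice_left {D : E × V →L[ℝ] W} {x : E} {ξ : V}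
    (h : HasFDerivWithinAt (fun p : E × V => F p.1 p.2) D (univ ×ˢ Ξ) (x, ξ)) (hξ : ξ ∈ Ξ) :
    HasFDerivAt (fun y => F y ξ) (D ∘L .inl ℝ E V) x :=
  have hmaps : MapsTo (fun y : E => (y, ξ)) univ (univ ×ˢ Ξ) := fun y _ => ⟨mem_univ y, hξ⟩
  hasFDerivWithinAt_univ.1 (HasFDerivWithinAt.comp (g := fun p : E × V => F p.1 p.2) x h
    (hasFDerivAt_prodMk_left x ξ).hasFDerivWithinAt hmaps)

theorem hasFDerivWithinAt_slice_right {D : E × V →L[ℝ] W} {x : E} {ξ : V}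
    (h : HasFDerivWithinAt (fun p : E × V => F p.1 p.2) D (univ ×ˢ Ξ) (x, ξ)) :
    HasFDerivWithinAt (fun η => F x η) (D ∘L .inr ℝ E V) Ξ ξ :=
  h.comp ξ (hasFDerivAt_prodMk_right x ξ).hasFDerivWithinAt fun _ hη => ⟨mem_univ x, hη⟩

theorem hasFDerivWithinAt_coprod_slices {x : E} {ξ : V} (hξ : ξ ∈ Ξ)
    (hΞ : UniqueDiffWithinAt ℝ Ξ ξ)
    (h : DifferentiableWithinAt ℝ (fun p : E × V => F p.1 p.2) (univ ×ˢ Ξ) (x, ξ)) :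
    HasFDerivWithinAt (fun p : E × V => F p.1 p.2)
      ((fderiv ℝ (fun y => F y ξ) x).coprod (fderivWithin ℝ (fun η => F x η) Ξ ξ))
      (univ ×ˢ Ξ) (x, ξ) := by
  have hD := h.hasFDerivWithinAt
  rw [(hasFDerivAt_slice_left hD hξ).fderiv,
    (hasFDerivWithinAt_slice_right hD).fderivWithin hΞ]
  convert hD using 1
  ext <;> simp

theorem differentiable_slice_left
    (h : DifferentiableOn ℝ (fun p : E × V => F p.1 p.2) (univ ×ˢ Ξ)) {ξ : V} (hξ : ξ ∈ Ξ) :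
    Differentiable ℝ fun y => F y ξ := fun x =>
  (hasFDerivAt_slice_left (h (x, ξ) ⟨mem_univ x, hξ⟩).hasFDerivWithinAt hξ).differentiableAt

theorem contDiffOn_fderiv_slice_left
    (h : ContDiffOn ℝ 2 (fun p : E × V => F p.1 p.2) (univ ×ˢ Ξ)) :
    ContDiffOn ℝ 1 (fun p : E × V => fderiv ℝ (fun y => F y p.2) p.1) (univ ×ˢ Ξ) := by
  intro p hp
  have hmaps : MapsTo (fun q : (E × V) × E => (q.2, q.1.2)) ((univ ×ˢ Ξ) ×ˢ univ) (univ ×ˢ Ξ) :=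
    fun q hq => ⟨mem_univ _, hq.1.2⟩
  have hF : ContDiffWithinAt ℝ 2 (Function.uncurry fun (q : E × V) (y : E) => F y q.2)
      ((univ ×ˢ Ξ) ×ˢ univ) (p, p.1) :=
    (h p hp).comp (p, p.1) (contDiff_snd.prodMk (contDiff_snd.comp contDiff_fst)).contDiffWithinAt
      hmaps
  simpa only [fderivWithin_univ] using hF.fderivWithin (m := 1) contDiffWithinAt_fst
    uniqueDiffOn_univ (by norm_num) hp fun _ _ => mem_univ _

end PartialDerivatives

theorem contDiffOn_gradient_slice_left {E V : Type*} [NormedAddCommGroup E]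
    [InnerProductSpace ℝ E] [CompleteSpace E] [NormedAddCommGroup V] [NormedSpace ℝ V] {Ξ : Set V}
    {φ : E → V → ℝ} (h : ContDiffOn ℝ 2 (fun p : E × V => φ p.1 p.2) (univ ×ˢ Ξ)) :
    ContDiffOn ℝ 1 (fun p : E × V => gradient (fun y => φ y p.2) p.1) (univ ×ˢ Ξ) :=
  (toDual ℝ E).symm.contDiff.comp_contDiffOn (contDiffOn_fderiv_slice_left h)

section LocalToGlobal

variable {V W : Type*} [NormedAddCommGroup V] [NormedAddCommGroup W]

theorem norm_sub_le_of_forall_eventually_nhdsGT {φ : ℝ → W} {a b C : ℝ} (hab : a ≤ b)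
    (hφ : ContinuousOn φ (Icc a b))
    (hbound : ∀ t ∈ Ico a b, ∀ C' > C, ∀ᶠ t' in 𝓝[>] t, ‖φ t' - φ t‖ ≤ C' * (t' - t)) :
    ‖φ b - φ a‖ ≤ C * (b - a) := by
  refine image_le_of_liminf_slope_right_le_deriv_boundary (f := fun t => ‖φ t - φ a‖)
    (B := fun t => C * (t - a)) (B' := fun _ => C)
    (hφ.sub continuousOn_const).norm (by simp) (by fun_prop)
    (fun t _ => by simpa using (((hasDerivAt_id t).sub_const a).const_mul C).hasDerivWithinAt)
    (fun t ht C₁ hC₁ => ?_) (right_mem_Icc.2 hab)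
  obtain ⟨C', hC, hC'⟩ := exists_between hC₁
  refine Eventually.frequently ?_
  filter_upwards [hbound t ht C' hC, self_mem_nhdsWithin] with t' ht' (htt' : t < t')
  have hsub := sub_pos.2 htt'
  rw [slope_def_field, div_lt_iff₀ hsub]
  calc ‖φ t' - φ a‖ - ‖φ t - φ a‖ ≤ ‖φ t' - φ t‖ := by
        simpa using norm_sub_norm_le (φ t' - φ a) (φ t - φ a)
    _ ≤ C' * (t' - t) := ht'
    _ < C₁ * (t' - t) := by gcongr

theorem continuousWithinAt_of_eventually_norm_sub_le {s : Set V} {φ : V → W} {C : ℝ} {x : V}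
    (hφ : ∀ᶠ y in 𝓝[s] x, ‖φ y - φ x‖ ≤ C * ‖y - x‖) : ContinuousWithinAt φ s x := by
  refine tendsto_iff_norm_sub_tendsto_zero.2
    (squeeze_zero' (.of_forall fun _ => norm_nonneg _) hφ ?_)
  have hcont : Continuous fun y : V => C * ‖y - x‖ := by fun_prop
  simpa using (hcont.tendsto x).mono_left nhdsWithin_le_nhds

theorem norm_sub_le_of_forall_eventually_norm_sub_le [NormedSpace ℝ V] {s : Set V}
    (hs : Convex ℝ s) {φ : V → W} {C : ℝ}
    (hφ : ∀ x ∈ s, ∀ C' > C, ∀ᶠ y in 𝓝[s] x, ‖φ y - φ x‖ ≤ C' * ‖y - x‖)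
    {x y : V} (hx : x ∈ s) (hy : y ∈ s) : ‖φ y - φ x‖ ≤ C * ‖y - x‖ := by
  rcases eq_or_ne y x with rfl | hne
  · simp
  have hpos : 0 < ‖y - x‖ := norm_pos_iff.2 (sub_ne_zero.2 hne)
  let γ : ℝ → V := AffineMap.lineMap x y
  have hγs : MapsTo γ (Icc 0 1) s := fun t ht => hs.lineMap_mem hx hy ht
  have hγc : Continuous γ := AffineMap.lineMap_continuous
  have hγ_sub (t t' : ℝ) : ‖γ t' - γ t‖ = |t' - t| * ‖y - x‖ := by
    rw [← dist_eq_norm, dist_lineMap_lineMap, Real.dist_eq, dist_comm, dist_eq_norm]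
  have hcont : ContinuousOn φ s := fun z hz =>
    continuousWithinAt_of_eventually_norm_sub_le (hφ z hz _ (lt_add_one C))
  have hbound : ∀ t ∈ Ico (0 : ℝ) 1, ∀ C' > C * ‖y - x‖,
      ∀ᶠ t' in 𝓝[>] t, ‖φ (γ t') - φ (γ t)‖ ≤ C' * (t' - t) := by
    intro t ht C' hC'
    have hlim : Tendsto γ (𝓝[>] t) (𝓝[s] (γ t)) :=
      (hγc.continuousWithinAt.tendsto_nhdsWithin hγs).mono_left
        (nhdsWithin_le_of_mem (Icc_mem_nhdsGT_of_mem ht))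
    filter_upwards [hlim.eventually (hφ (γ t) (hγs (Ico_subset_Icc_self ht)) (C' / ‖y - x‖)
      ((lt_div_iff₀ hpos).2 hC')), self_mem_nhdsWithin] with t' ht' (htt' : t < t')
    rwa [hγ_sub, abs_of_pos (sub_pos.2 htt'), mul_left_comm, div_mul_cancel₀ _ hpos.ne',
      mul_comm] at ht'
  simpa [γ] using norm_sub_le_of_forall_eventually_nhdsGT zero_le_one
    (hcont.comp hγc.continuousOn hγs) hbound

end LocalToGlobal

theorem eventually_le_of_le_add_isLittleO {X : Type*} {l : Filter X} {T Δ η e : X → ℝ}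
    {K C K' : ℝ} (hK : 0 ≤ K) (hC : 0 ≤ C) (hΔ : ∀ᶠ ξ in l, 0 ≤ Δ ξ)
    (hT : ∀ᶠ ξ in l, T ξ ≤ K * η ξ + e ξ) (hΔT : ∀ᶠ ξ in l, Δ ξ ≤ C * T ξ + η ξ)
    (he : e =o[l] Δ) (hK' : K < K') : ∀ᶠ ξ in l, T ξ ≤ K' * η ξ := by
  have hden : 0 < 1 + K' * C := by have := mul_nonneg (hK.trans hK'.le) hC; linarith
  set δ := (K' - K) / (1 + K' * C) with hδ
  have hδ_pos : 0 < δ := div_pos (sub_pos.2 hK') hden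
  have hδ_eq : δ + K' * (δ * C) = K' - K := by rw [hδ]; field_simp
  have hδC : δ * C < 1 := by
    rw [hδ, div_mul_eq_mul_div, div_lt_one hden]
    nlinarith [mul_nonneg hK hC]
  filter_upwards [hΔ, hT, hΔT, he.def hδ_pos] with ξ hΔ hT hΔT he
  rw [Real.norm_of_nonneg hΔ] at he
  have hbound : T ξ ≤ K * η ξ + δ * (C * T ξ + η ξ) := by
    have := mul_le_mul_of_nonneg_left hΔT hδ_pos.le
    linarith [Real.le_norm_self (e ξ)]
  have hfactor : (1 - δ * C) * T ξ ≤ (1 - δ * C) * (K' * η ξ) := by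
    calc (1 - δ * C) * T ξ ≤ (K + δ) * η ξ := by linarith
      _ = (1 - δ * C) * (K' * η ξ) := by
        rw [show K + δ = (1 - δ * C) * K' by linarith, mul_assoc]
  exact le_of_mul_le_mul_left hfactor (sub_pos.2 hδC)

section FirstOrder

variable {E ι : Type*} [NormedAddCommGroup E] [NormedSpace ℝ E] [Finite ι]

theorem mem_posTangentConeAt_of_apply_neg {g : E → ι → ℝ} {x d : E} {D : ι → E →L[ℝ] ℝ}
    (hg : ∀ i, HasFDerivAt (fun y => g y i) (D i) x) (hx : ∀ i, g x i ≤ 0)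
    (hd : ∀ i, g x i = 0 → D i d < 0) : d ∈ posTangentConeAt {y | ∀ i, g y i ≤ 0} x := by
  refine mem_posTangentConeAt_of_frequently_mem (Eventually.frequently ?_)
  refine eventually_all.2 fun i => ?_
  rcases (hx i).lt_or_eq with hlt | heq
  · have hcont : Tendsto (fun t : ℝ => g (x + t • d) i) (𝓝[>] 0) (𝓝 (g x i)) := by
      have hline : Tendsto (fun t : ℝ => x + t • d) (𝓝[>] 0) (𝓝 x) := by
        simpa using ((show Continuous fun t : ℝ => x + t • d by fun_prop).tendsto 0).mono_left
          nhdsWithin_le_nhds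
      exact (hg i).continuousAt.tendsto.comp hline
    exact (hcont.eventually_lt_const hlt).mono fun _ => le_of_lt
  · have hslope := ((hg i).hasLineDerivAt d).tendsto_slope_zero_right
    filter_upwards [hslope.eventually_lt_const (hd i heq), self_mem_nhdsWithin] with t ht
      (ht0 : 0 < t)
    rw [heq, sub_zero, smul_eq_mul] at ht
    exact (neg_of_mul_neg_right ht (inv_pos.2 ht0).le).le

end FirstOrder

theorem tendsto_prodMk_nhdsWithin_univ_prod {E V : Type*} [TopologicalSpace E]
    [TopologicalSpace V] {Ξ : Set V} {γ : V → E} {ξ₀ : V} (hγ : ContinuousWithinAt γ Ξ ξ₀) :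
    Tendsto (fun ξ => (γ ξ, ξ)) (𝓝[Ξ] ξ₀) (𝓝[univ ×ˢ Ξ] (γ ξ₀, ξ₀)) :=
  (hγ.prodMk continuousWithinAt_id).tendsto_nhdsWithin fun _ hξ => ⟨mem_univ _, hξ⟩

section Expansion

variable {E V W : Type*} [NormedAddCommGroup E] [NormedSpace ℝ E] [NormedAddCommGroup V]
  [NormedSpace ℝ V] [NormedAddCommGroup W] [NormedSpace ℝ W] {Ξ : Set V} {F : E → V → W}
  {γ : V → E} {ξ₀ : V}

theorem isLittleO_sub_slice_derivs (hγ : ContinuousWithinAt γ Ξ ξ₀) (hξ₀ : ξ₀ ∈ Ξ)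
    (hΞ : UniqueDiffWithinAt ℝ Ξ ξ₀)
    (hF : DifferentiableWithinAt ℝ (fun p : E × V => F p.1 p.2) (univ ×ˢ Ξ) (γ ξ₀, ξ₀)) :
    (fun ξ => F (γ ξ) ξ - F (γ ξ₀) ξ₀ - (fderiv ℝ (fun y => F y ξ₀) (γ ξ₀) (γ ξ - γ ξ₀)
      + fderivWithin ℝ (fun η => F (γ ξ₀) η) Ξ ξ₀ (ξ - ξ₀)))
      =o[𝓝[Ξ] ξ₀] fun ξ => ‖γ ξ - γ ξ₀‖ + ‖ξ - ξ₀‖ := by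
  have hexp := (hasFDerivWithinAt_coprod_slices hξ₀ hΞ hF).isLittleO.comp_tendsto
    (tendsto_prodMk_nhdsWithin_univ_prod hγ)
  refine hexp.trans_isBigO (.of_bound 1 (.of_forall fun ξ => ?_))
  rw [one_mul, Real.norm_of_nonneg (by positivity)]
  exact max_le_add_of_nonneg (norm_nonneg _) (norm_nonneg _)

theorem isLittleO_apply_of_tendsto_zero {X : Type*} {l : Filter X} {A : X → V →L[ℝ] W}
    (hA : Tendsto A l (𝓝 0)) (v : X → V) : (fun ξ => A ξ (v ξ)) =o[l] v := by
  have hmul := ((Asymptotics.isLittleO_one_iff ℝ).2 hA).norm_left.mul_isBigO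
    (Asymptotics.isBigO_refl (fun ξ => ‖v ξ‖) l)
  simp only [one_mul] at hmul
  refine (Asymptotics.IsBigO.trans_isLittleO (.of_norm_le fun ξ => ?_) hmul).of_norm_right
  exact (A ξ).le_opNorm (v ξ)

end Expansion

namespace ParamProgram

variable {n m r : ℕ} {Ξ : Set (Euc r)} {f : Euc n → Euc r → ℝ} {g : Euc n → Euc r → Euc m}
  {α B ω : ℝ} {x x₀ : Euc n} {μ μ₀ : Euc m} {xs : Euc r → Euc n} {μs : Euc r → Euc m}
  {ξ ξ₀ : Euc r}

section Lagrangian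

theorem lagrangian_eq_add_inner (f : Euc n → Euc r → ℝ) (g : Euc n → Euc r → Euc m) (x : Euc n)
    (μ : Euc m) (ξ : Euc r) : lagrangian f g x μ ξ = f x ξ + ⟪μ, g x ξ⟫_ℝ := by
  simp [lagrangian, PiLp.inner_apply, mul_comm]

theorem hasGradientAt_lagrangian (hf : DifferentiableAt ℝ (fun y => f y ξ) x)
    (hg : DifferentiableAt ℝ (fun y => g y ξ) x) :
    HasGradientAt (fun y => lagrangian f g y μ ξ)
      (gradient (fun y => f y ξ) x + (fderiv ℝ (fun y => g y ξ) x).adjoint μ) x := by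
  simp only [lagrangian_eq_add_inner]
  have hcomp := hf.hasFDerivAt.add ((innerSL ℝ μ).hasFDerivAt.comp x hg.hasFDerivAt)
  refine hasGradientAt_iff_hasFDerivAt.2 (hcomp.congr_fderiv ?_)
  ext v
  simp [ContinuousLinearMap.adjoint_inner_left, gradient]

theorem contDiffOn_lagrangian {k : WithTop ℕ∞}
    (hf : ContDiffOn ℝ k (fun p : Euc n × Euc r => f p.1 p.2) (univ ×ˢ Ξ))
    (hg : ContDiffOn ℝ k (fun p : Euc n × Euc r => g p.1 p.2) (univ ×ˢ Ξ)) (μ : Euc m) :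
    ContDiffOn ℝ k (fun p : Euc n × Euc r => lagrangian f g p.1 μ p.2) (univ ×ˢ Ξ) := by
  simp only [lagrangian_eq_add_inner]
  exact hf.add (contDiffOn_const.inner ℝ hg)

theorem strongConvexOn_lagrangian (hf : StrongConvexOn univ α fun y => f y ξ)
    (hg : ∀ i, ConvexOn ℝ univ fun y => g y ξ i) (hμ : ∀ i, 0 ≤ μ i) :
    StrongConvexOn univ α fun y => lagrangian f g y μ ξ := by
  have hsum : ConvexOn ℝ univ fun y => ∑ i, μ i * g y ξ i := by
    classical
    induction (Finset.univ : Finset (Fin m)) using Finset.induction_on with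
    | empty => simpa using convexOn_const (0 : ℝ) convex_univ
    | insert i s hi ih =>
      simp only [Finset.sum_insert hi]
      exact ((hg i).smul (hμ i)).add ih
  refine UniformConvexOn.mono (le_of_eq ?_) (UniformConvexOn.add hf (strongConvexOn_zero.2 hsum))
  ext t
  simp

theorem inner_apply_nonpos_of_mem_feasible (hμ : ∀ i, 0 ≤ μ i) (hx : x ∈ feasible g ξ) :
    ⟪μ, g x ξ⟫_ℝ ≤ 0 := by
  rw [PiLp.inner_apply]
  exact Finset.sum_nonpos fun i _ => mul_nonpos_of_nonpos_of_nonneg (hx i) (hμ i)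

theorem IsKKT.inner_eq_zero (h : IsKKT f g ξ x μ) : ⟪μ, g x ξ⟫_ℝ = 0 := by
  rw [PiLp.inner_apply]
  refine Finset.sum_eq_zero fun i _ => ?_
  rcases (h.feasible i).lt_or_eq with hlt | heq
  · simp [h.slack i hlt]
  · simp [heq]

theorem IsKKT.eq_zero_of_apply_ne_zero (h : IsKKT f g ξ x μ) {i : Fin m} (hi : g x ξ i ≠ 0) :
    μ i = 0 :=
  h.slack i ((h.feasible i).lt_of_ne hi)

theorem IsKKT.gradient_add_adjoint_eq_zero (h : IsKKT f g ξ x μ)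
    (hf : DifferentiableAt ℝ (fun y => f y ξ) x) (hg : DifferentiableAt ℝ (fun y => g y ξ) x) :
    gradient (fun y => f y ξ) x + (fderiv ℝ (fun y => g y ξ) x).adjoint μ = 0 :=
  (hasGradientAt_lagrangian hf hg).gradient.symm.trans h.stationary

end Lagrangian

section ActiveDeriv

/-- The derivative in `x` of the constraints active at `(x, ξ)`, i.e. `activeJacobian g x ξ` as a
continuous linear map. -/
noncomputable def activeDeriv (g : Euc n → Euc r → Euc m) (x : Euc n) (ξ : Euc r) :
    Euc n →L[ℝ] EuclideanSpace ℝ (Active g x ξ) :=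
  coordRestrict (g x ξ · = 0) ∘L fderiv ℝ (fun y => g y ξ) x

theorem hasFDerivAt_constraint (hg : DifferentiableAt ℝ (fun y => g y ξ) x) (i : Fin m) :
    HasFDerivAt (fun y => g y ξ i) (EuclideanSpace.proj i ∘L fderiv ℝ (fun y => g y ξ) x) x :=
  (EuclideanSpace.proj i : Euc m →L[ℝ] ℝ).hasFDerivAt.comp x hg.hasFDerivAt

theorem inner_gradient_constraint (hg : DifferentiableAt ℝ (fun y => g y ξ) x) (i : Fin m)
    (v : Euc n) :
    ⟪gradient (fun y => g y ξ i) x, v⟫_ℝ = fderiv ℝ (fun y => g y ξ) x v i := by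
  rw [gradient, toDual_symm_apply, (hasFDerivAt_constraint hg i).fderiv]
  rfl

theorem toEuclideanLin_activeJacobian (hg : DifferentiableAt ℝ (fun y => g y ξ) x) :
    (activeJacobian g x ξ).toEuclideanLin = activeDeriv g x ξ := by
  refine LinearMap.ext fun v => PiLp.ext fun i => ?_
  have hgrad := inner_gradient_constraint hg i.1 v
  rw [PiLp.inner_apply] at hgrad
  simpa [activeDeriv, activeJacobian, Matrix.mulVec, dotProduct, mul_comm] using hgrad

theorem UniformLICQ.mul_norm_le (h : UniformLICQ g Ξ ω) (hξ : ξ ∈ Ξ) (hx : x ∈ feasible g ξ)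
    (hg : DifferentiableAt ℝ (fun y => g y ξ) x) (c : EuclideanSpace ℝ (Active g x ξ)) :
    ω * ‖c‖ ≤ ‖(activeDeriv g x ξ).adjoint c‖ := by
  classical
  rcases isEmpty_or_nonempty (Active g x ξ) with hempty | hnonempty
  · simp [Subsingleton.elim c 0]
  · convert mul_norm_le_norm_adjoint_of_posSemidef (h ξ hξ x hx hnonempty) c using 3
    rw [toEuclideanLin_activeJacobian hg]
    rfl

theorem adjoint_activeDeriv_coordRestrict {ν : Euc m} (hν : ∀ i, g x ξ i ≠ 0 → ν i = 0) :
    (activeDeriv g x ξ).adjoint (coordRestrict (g x ξ · = 0) ν) =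
      (fderiv ℝ (fun y => g y ξ) x).adjoint ν :=
  adjoint_comp_coordRestrict _ hν

theorem mul_norm_le_norm_adjoint_fderiv
    (h : ∀ c, ω * ‖c‖ ≤ ‖(activeDeriv g x ξ).adjoint c‖) {ν : Euc m}
    (hν : ∀ i, g x ξ i ≠ 0 → ν i = 0) :
    ω * ‖ν‖ ≤ ‖(fderiv ℝ (fun y => g y ξ) x).adjoint ν‖ := by
  rw [← norm_coordRestrict hν, ← adjoint_activeDeriv_coordRestrict hν]
  exact h _

end ActiveDeriv

section SolutionMaps

theorem isClosed_feasible (hg : Continuous fun y => g y ξ) : IsClosed (feasible g ξ) := by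
  simp only [feasible, ofPred_forall]
  exact isClosed_iInter fun i => isClosed_le (by fun_prop) continuous_const

theorem convex_feasible (hg : ∀ i, ConvexOn ℝ univ fun y => g y ξ i) :
    Convex ℝ (feasible g ξ) := by
  simp only [feasible, ofPred_forall]
  exact convex_iInter fun i => by simpa using (hg i).convex_le 0

theorem exists_primalSolutions_eq_singleton (hα : 0 < α)
    (hf : StrongConvexOn univ α fun y => f y ξ) (hfd : Differentiable ℝ fun y => f y ξ)
    (hg : ∀ i, ConvexOn ℝ univ fun y => g y ξ i) (hgc : Continuous fun y => g y ξ)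
    (hne : (feasible g ξ).Nonempty) : ∃ x, primalSolutions f g ξ = {x} := by
  obtain ⟨x, hx⟩ := exists_isMinOn_of_strongConvexOn hα hf hfd (isClosed_feasible hgc) hne
  refine ⟨x, eq_singleton_iff_unique_mem.2 ⟨hx, fun y hy => ?_⟩⟩
  exact ((hf.strictConvexOn hα).subset (subset_univ _) (convex_feasible hg)).eq_of_isMinOn
    hy.2 hx.2 hy.1 hx.1

theorem inner_gradient_nonneg_of_mem_primalSolutions (hx : x ∈ primalSolutions f g ξ)
    (hf : DifferentiableAt ℝ (fun y => f y ξ) x) (hg : DifferentiableAt ℝ (fun y => g y ξ) x)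
    {d : Euc n} (hd : ∀ i, activeDeriv g x ξ d i < 0) :
    0 ≤ ⟪gradient (fun y => f y ξ) x, d⟫_ℝ := by
  rw [gradient, toDual_symm_apply]
  refine hx.2.localize.hasFDerivWithinAt_nonneg hf.hasFDerivAt.hasFDerivWithinAt ?_
  exact mem_posTangentConeAt_of_apply_neg (g := fun y i => g y ξ i)
    (hasFDerivAt_constraint hg) hx.1 fun i hi => hd ⟨i, hi⟩

theorem exists_isKKT (hω : 0 < ω) (h : ∀ c, ω * ‖c‖ ≤ ‖(activeDeriv g x ξ).adjoint c‖)
    (hx : x ∈ primalSolutions f g ξ) (hf : DifferentiableAt ℝ (fun y => f y ξ) x)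
    (hg : DifferentiableAt ℝ (fun y => g y ξ) x) : ∃ μ, IsKKT f g ξ x μ := by
  obtain ⟨c, hc, hstat⟩ := exists_nonneg_add_adjoint_eq_zero
    (surjective_of_mul_norm_le_norm_adjoint hω h)
    fun d hd => inner_gradient_nonneg_of_mem_primalSolutions hx hf hg hd
  obtain ⟨μ, hμ, rfl⟩ := exists_coordRestrict_eq c
  rw [adjoint_activeDeriv_coordRestrict hμ] at hstat
  refine ⟨μ, hx.1, fun i => ?_, (hasGradientAt_lagrangian hf hg).gradient.trans hstat,
    fun i hi => hμ i hi.ne⟩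
  by_cases hi : g x ξ i = 0
  · exact hc ⟨i, hi⟩
  · exact (hμ i hi).ge

theorem IsKKT.multiplier_unique {ν : Euc m} (hω : 0 < ω)
    (h : ∀ c, ω * ‖c‖ ≤ ‖(activeDeriv g x ξ).adjoint c‖)
    (hf : DifferentiableAt ℝ (fun y => f y ξ) x) (hg : DifferentiableAt ℝ (fun y => g y ξ) x)
    (hμ : IsKKT f g ξ x μ) (hν : IsKKT f g ξ x ν) : μ = ν := by
  have hsub : (fderiv ℝ (fun y => g y ξ) x).adjoint (μ - ν) = 0 := by
    rw [map_sub, sub_eq_zero]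
    exact add_left_cancel ((hμ.gradient_add_adjoint_eq_zero hf hg).trans
      (hν.gradient_add_adjoint_eq_zero hf hg).symm)
  have hle := mul_norm_le_norm_adjoint_fderiv h (ν := μ - ν) fun i hi => by
    simp [hμ.eq_zero_of_apply_ne_zero hi, hν.eq_zero_of_apply_ne_zero hi]
  rw [hsub, norm_zero] at hle
  exact sub_eq_zero.1 (norm_le_zero_iff.1 (nonpos_of_mul_nonpos_right hle hω))

theorem exists_dualSolutions_eq_singleton (hω : 0 < ω)
    (h : ∀ c, ω * ‖c‖ ≤ ‖(activeDeriv g x ξ).adjoint c‖) (hx : primalSolutions f g ξ = {x})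
    (hf : DifferentiableAt ℝ (fun y => f y ξ) x) (hg : DifferentiableAt ℝ (fun y => g y ξ) x) :
    ∃ μ, dualSolutions f g ξ = {μ} ∧ IsKKT f g ξ x μ := by
  obtain ⟨μ, hμ⟩ := exists_isKKT hω h (hx ▸ mem_singleton x) hf hg
  refine ⟨μ, eq_singleton_iff_unique_mem.2 ⟨⟨x, hx ▸ mem_singleton x, hμ⟩, ?_⟩, hμ⟩
  rintro ν ⟨y, hy, hν⟩
  obtain rfl : y = x := by rwa [hx] at hy
  exact hν.multiplier_unique hω h hf hg hμ

end SolutionMaps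

section HessianBound

theorem adjoint_fderiv_apply_eq_sum (hg : DifferentiableAt ℝ (fun y => g y ξ) x) (μ : Euc m) :
    (fderiv ℝ (fun y => g y ξ) x).adjoint μ = ∑ i, μ i • gradient (fun y => g y ξ i) x := by
  refine ext_inner_right ℝ fun v => ?_
  rw [ContinuousLinearMap.adjoint_inner_left, PiLp.inner_apply, sum_inner]
  refine Finset.sum_congr rfl fun i _ => ?_
  rw [real_inner_smul_left, inner_gradient_constraint hg, Real.inner_apply]

theorem norm_gradient_lagrangian_sub_le {β : ℝ≥0} {l : Fin m → ℝ≥0} {ζ : Fin m → ℝ}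
    (hfd : Differentiable ℝ fun y => f y ξ) (hgd : Differentiable ℝ fun y => g y ξ)
    (hf : LipschitzWith β (gradient fun y => f y ξ))
    (hg : ∀ i, LipschitzWith (l i) (gradient fun y => g y ξ i))
    (hμ : ∀ i, 0 ≤ μ i) (hμζ : ∀ i, μ i ≤ ζ i) (y z : Euc n) :
    ‖gradient (fun w => lagrangian f g w μ ξ) y - gradient (fun w => lagrangian f g w μ ξ) z‖ ≤
      (β + ∑ i, ζ i * l i) * ‖y - z‖ := by
  rw [(hasGradientAt_lagrangian (hfd y) (hgd y)).gradient,
    (hasGradientAt_lagrangian (hfd z) (hgd z)).gradient, adjoint_fderiv_apply_eq_sum (hgd y),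
    adjoint_fderiv_apply_eq_sum (hgd z), add_sub_add_comm, ← Finset.sum_sub_distrib, add_mul,
    Finset.sum_mul]
  refine norm_add_le_of_le (hf.norm_sub_le y z) (norm_sum_le_of_le _ fun i _ => ?_)
  rw [← smul_sub, norm_smul, Real.norm_of_nonneg (hμ i), mul_assoc]
  exact mul_le_mul (hμζ i) ((hg i).norm_sub_le y z) (norm_nonneg _) ((hμ i).trans (hμζ i))

end HessianBound

section Continuity

theorem IsKKT.mul_norm_sub_sq_le (hf : StrongConvexOn univ α fun y => f y ξ)
    (hg : ∀ i, ConvexOn ℝ univ fun y => g y ξ i) (hfd : Differentiable ℝ fun y => f y ξ)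
    (hgd : Differentiable ℝ fun y => g y ξ) (h₀ : IsKKT f g ξ₀ x₀ μ₀) (h : IsKKT f g ξ x μ) :
    α * ‖x - x₀‖ ^ 2 ≤ ⟪μ - μ₀, g x₀ ξ - g x₀ ξ₀⟫_ℝ
      - ⟪gradient (fun y => lagrangian f g y μ₀ ξ) x₀, x - x₀⟫_ℝ := by
  have hmin := strongConvexOn_add_inner_add_le (strongConvexOn_lagrangian hf hg h.nonneg)
    (hasGradientAt_lagrangian (hfd x) (hgd x)) x₀
  have hlow := strongConvexOn_add_inner_add_le (strongConvexOn_lagrangian hf hg h₀.nonneg)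
    (hasGradientAt_lagrangian (hfd x₀) (hgd x₀)) x
  rw [h.gradient_add_adjoint_eq_zero (hfd x) (hgd x), inner_zero_left, norm_sub_rev] at hmin
  rw [← (hasGradientAt_lagrangian (hfd x₀) (hgd x₀)).gradient] at hlow
  generalize gradient (fun y => lagrangian f g y μ₀ ξ) x₀ = p at hlow ⊢
  simp only [lagrangian_eq_add_inner] at hmin hlow
  have hslack := h.inner_eq_zero
  have hslack₀ := h₀.inner_eq_zero
  have hx := inner_apply_nonpos_of_mem_feasible h₀.nonneg h.feasible
  have hx₀ := inner_apply_nonpos_of_mem_feasible h.nonneg h₀.feasible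
  rw [inner_sub_left, inner_sub_right, inner_sub_right]
  linarith

theorem continuousOn_primal {C : ℝ} (hα : 0 < α)
    (hf : ContDiffOn ℝ 2 (fun p : Euc n × Euc r => f p.1 p.2) (univ ×ˢ Ξ))
    (hg : ContDiffOn ℝ 2 (fun p : Euc n × Euc r => g p.1 p.2) (univ ×ˢ Ξ))
    (hfconv : ∀ ξ ∈ Ξ, StrongConvexOn univ α fun y => f y ξ)
    (hgconv : ∀ ξ ∈ Ξ, ∀ i, ConvexOn ℝ univ fun y => g y ξ i)
    (h : ∀ ξ ∈ Ξ, IsKKT f g ξ (xs ξ) (μs ξ)) (hC : ∀ ξ ∈ Ξ, ‖μs ξ‖ ≤ C) :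
    ContinuousOn xs Ξ := by
  intro ξ₀ hξ₀
  have hslice : MapsTo (fun ξ : Euc r => (xs ξ₀, ξ)) Ξ (univ ×ˢ Ξ) := fun ξ hξ => ⟨mem_univ _, hξ⟩
  set p : Euc r → Euc n := fun ξ => gradient (fun y => lagrangian f g y (μs ξ₀) ξ) (xs ξ₀)
  have hp : ContinuousWithinAt p Ξ ξ₀ :=
    (contDiffOn_gradient_slice_left (contDiffOn_lagrangian hf hg (μs ξ₀))).continuousOn.comp
      (by fun_prop) hslice ξ₀ hξ₀
  have hgc : ContinuousWithinAt (fun ξ => g (xs ξ₀) ξ) Ξ ξ₀ :=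
    hg.continuousOn.comp (f := fun ξ => (xs ξ₀, ξ)) (by fun_prop) hslice ξ₀ hξ₀
  have hbound : ∀ᶠ ξ in 𝓝[Ξ] ξ₀, ‖xs ξ - xs ξ₀‖ ≤
      ‖p ξ‖ / α + √(2 * C * ‖g (xs ξ₀) ξ - g (xs ξ₀) ξ₀‖ / α) := by
    filter_upwards [self_mem_nhdsWithin] with ξ hξ
    refine le_div_add_sqrt_of_mul_sq_le hα (norm_nonneg _) ?_
    have hle := (h ξ₀ hξ₀).mul_norm_sub_sq_le (hfconv ξ hξ) (hgconv ξ hξ)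
      (differentiable_slice_left (hf.differentiableOn two_ne_zero) hξ)
      (differentiable_slice_left (hg.differentiableOn two_ne_zero) hξ) (h ξ hξ)
    have hinner := (neg_le_abs _).trans (abs_real_inner_le_norm (p ξ) (xs ξ - xs ξ₀))
    have hμ : ‖μs ξ - μs ξ₀‖ ≤ 2 * C := (norm_sub_le_of_le (hC ξ hξ) (hC ξ₀ hξ₀)).trans_eq
      (two_mul C).symm
    have hinner' := (real_inner_le_norm (μs ξ - μs ξ₀) (g (xs ξ₀) ξ - g (xs ξ₀) ξ₀)).trans
      (mul_le_mul_of_nonneg_right hμ (norm_nonneg _))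
    linarith
  refine tendsto_iff_norm_sub_tendsto_zero.2
    (squeeze_zero' (.of_forall fun _ => norm_nonneg _) hbound ?_)
  have hlim := (hp.norm.div_const α).tendsto.add (((hgc.sub (continuousWithinAt_const
    (b := g (xs ξ₀) ξ₀))).norm.const_mul (2 * C)).div_const α).sqrt.tendsto
  simpa [p, (h ξ₀ hξ₀).stationary] using hlim

end Continuity

section Linearisation

theorem IsKKT.gradient_lagrangian_eq (h : IsKKT f g ξ x μ)
    (hf : DifferentiableAt ℝ (fun y => f y ξ) x)
    (hg : DifferentiableAt ℝ (fun y => g y ξ) x) (ν : Euc m) :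
    gradient (fun y => lagrangian f g y ν ξ) x =
      -(fderiv ℝ (fun y => g y ξ) x).adjoint (μ - ν) := by
  rw [(hasGradientAt_lagrangian hf hg).gradient, map_sub,
    eq_neg_of_add_eq_zero_left (h.gradient_add_adjoint_eq_zero hf hg)]
  abel

theorem isLittleO_stationarity (hΞ : UniqueDiffWithinAt ℝ Ξ ξ₀) (hξ₀ : ξ₀ ∈ Ξ)
    (hf : ContDiffOn ℝ 2 (fun p : Euc n × Euc r => f p.1 p.2) (univ ×ˢ Ξ))
    (hg : ContDiffOn ℝ 2 (fun p : Euc n × Euc r => g p.1 p.2) (univ ×ˢ Ξ))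
    (hxs : ContinuousWithinAt xs Ξ ξ₀) (h : ∀ ξ ∈ Ξ, IsKKT f g ξ (xs ξ) (μs ξ)) :
    (fun ξ => fderiv ℝ (gradient fun y => lagrangian f g y (μs ξ₀) ξ₀) (xs ξ₀) (xs ξ - xs ξ₀)
        + (fderiv ℝ (fun y => g y ξ₀) (xs ξ₀)).adjoint (μs ξ - μs ξ₀)
        + mixedHessian f g Ξ (xs ξ₀) (μs ξ₀) ξ₀ (ξ - ξ₀))
      =o[𝓝[Ξ] ξ₀] fun ξ => ‖xs ξ - xs ξ₀‖ + ‖μs ξ - μs ξ₀‖ + ‖ξ - ξ₀‖ := by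
  have hmem : (xs ξ₀, ξ₀) ∈ (univ : Set (Euc n)) ×ˢ Ξ := ⟨mem_univ _, hξ₀⟩
  have hfd {ξ} (hξ : ξ ∈ Ξ) : Differentiable ℝ fun y => f y ξ :=
    differentiable_slice_left (hf.differentiableOn two_ne_zero) hξ
  have hgd {ξ} (hξ : ξ ∈ Ξ) : Differentiable ℝ fun y => g y ξ :=
    differentiable_slice_left (hg.differentiableOn two_ne_zero) hξ
  have hprimal (ξ : Euc r) : ‖‖xs ξ - xs ξ₀‖ + ‖ξ - ξ₀‖‖ ≤
      ‖xs ξ - xs ξ₀‖ + ‖μs ξ - μs ξ₀‖ + ‖ξ - ξ₀‖ := by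
    rw [Real.norm_of_nonneg (by positivity)]
    linarith [norm_nonneg (μs ξ - μs ξ₀)]
  have hdual (ξ : Euc r) : ‖μs ξ - μs ξ₀‖ ≤
      ‖xs ξ - xs ξ₀‖ + ‖μs ξ - μs ξ₀‖ + ‖ξ - ξ₀‖ := by
    linarith [norm_nonneg (xs ξ - xs ξ₀), norm_nonneg (ξ - ξ₀)]
  have hgrad := isLittleO_sub_slice_derivs
    (F := fun x ξ => gradient (fun y => lagrangian f g y (μs ξ₀) ξ) x) hxs hξ₀ hΞ
    ((contDiffOn_gradient_slice_left (contDiffOn_lagrangian hf hg _)).differentiableOn one_ne_zero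
      _ hmem)
  have hadj : Tendsto (fun ξ => (fderiv ℝ (fun y => g y ξ₀) (xs ξ₀)).adjoint
      - (fderiv ℝ (fun y => g y ξ) (xs ξ)).adjoint) (𝓝[Ξ] ξ₀) (𝓝 0) := by
    have hD := ((contDiffOn_fderiv_slice_left hg).continuousOn _ hmem).tendsto.comp
      (tendsto_prodMk_nhdsWithin_univ_prod hxs)
    simpa using tendsto_const_nhds (x := (fderiv ℝ (fun y => g y ξ₀) (xs ξ₀)).adjoint).sub
      ((ContinuousLinearMap.adjoint.continuous.tendsto _).comp hD)
  have hremainder := isLittleO_apply_of_tendsto_zero hadj fun ξ => μs ξ - μs ξ₀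
  have hsum := (hgrad.neg_left.trans_isBigO (.of_norm_le hprimal)).add
    (hremainder.trans_isBigO (.of_norm_le hdual))
  refine hsum.congr' ?_ .rfl
  filter_upwards [self_mem_nhdsWithin] with ξ hξ
  rw [(h ξ hξ).gradient_lagrangian_eq (hfd hξ _) (hgd hξ _), (h ξ₀ hξ₀).stationary,
    sub_apply, mixedHessian]
  abel

theorem isLittleO_activeConstraints (hΞ : UniqueDiffWithinAt ℝ Ξ ξ₀) (hξ₀ : ξ₀ ∈ Ξ)
    (hg : DifferentiableOn ℝ (fun p : Euc n × Euc r => g p.1 p.2) (univ ×ˢ Ξ))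
    (hxs : ContinuousWithinAt xs Ξ ξ₀) :
    (fun ξ => activeDeriv g (xs ξ₀) ξ₀ (xs ξ - xs ξ₀)
        - coordRestrict (g (xs ξ₀) ξ₀ · = 0) (g (xs ξ) ξ)
        + activeParamDeriv g Ξ (xs ξ₀) ξ₀ (ξ - ξ₀))
      =o[𝓝[Ξ] ξ₀] fun ξ => ‖xs ξ - xs ξ₀‖ + ‖ξ - ξ₀‖ := by
  set R : Euc m →L[ℝ] EuclideanSpace ℝ (Active g (xs ξ₀) ξ₀) :=
    coordRestrict (g (xs ξ₀) ξ₀ · = 0) with hR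
  have hmem : (xs ξ₀, ξ₀) ∈ (univ : Set (Euc n)) ×ˢ Ξ := ⟨mem_univ _, hξ₀⟩
  have hexp := isLittleO_sub_slice_derivs (F := fun x ξ => R (g x ξ)) hxs hξ₀ hΞ
    (R.differentiableAt.comp_differentiableWithinAt _ (hg _ hmem))
  have hx : fderiv ℝ (fun y => R (g y ξ₀)) (xs ξ₀) = activeDeriv g (xs ξ₀) ξ₀ :=
    (R.hasFDerivAt.comp _ (differentiable_slice_left hg hξ₀ _).hasFDerivAt).fderiv
  have hzero : R (g (xs ξ₀) ξ₀) = 0 := by ext i; exact i.2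
  refine hexp.neg_left.congr_left fun ξ => ?_
  rw [hx, hzero, activeParamDeriv]
  simp only [hR, coordRestrict_eq_toLp]
  abel

theorem eventually_eq_zero_of_inactive (hξ₀ : ξ₀ ∈ Ξ)
    (hg : ContinuousOn (fun p : Euc n × Euc r => g p.1 p.2) (univ ×ˢ Ξ))
    (hxs : ContinuousWithinAt xs Ξ ξ₀) (h : ∀ ξ ∈ Ξ, IsKKT f g ξ (xs ξ) (μs ξ)) :
    ∀ᶠ ξ in 𝓝[Ξ] ξ₀, ∀ i, g (xs ξ₀) ξ₀ i ≠ 0 → μs ξ i = 0 := by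
  have hcont : Tendsto (fun ξ => g (xs ξ) ξ) (𝓝[Ξ] ξ₀) (𝓝 (g (xs ξ₀) ξ₀)) :=
    (hg (xs ξ₀, ξ₀) ⟨mem_univ _, hξ₀⟩).tendsto.comp (tendsto_prodMk_nhdsWithin_univ_prod hxs)
  refine eventually_all.2 fun i => ?_
  by_cases hi : g (xs ξ₀) ξ₀ i = 0
  · simp [hi]
  · have hcont_i : Tendsto (fun ξ => g (xs ξ) ξ i) (𝓝[Ξ] ξ₀) (𝓝 (g (xs ξ₀) ξ₀ i)) :=
      ((EuclideanSpace.proj i : Euc m →L[ℝ] ℝ).continuous.tendsto _).comp hcont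
    filter_upwards [hcont_i.eventually_ne hi, self_mem_nhdsWithin] with ξ hne hξ _
    exact (h ξ hξ).eq_zero_of_apply_ne_zero hne

end Linearisation

section Stability

/-- The weighted residual `‖H (x - x₀) + D† (μ - μ₀)‖ / α + ‖S (x - x₀) - R g(x, ξ)‖ / ω` of
`(x, μ, ξ)` in the KKT system linearised at `(x₀, μ₀, ξ₀)`, where `H` is the Hessian of the
Lagrangian, `D` the Jacobian of `g`, `R` the restriction to the active constraints and `S = R D`.
The term `R g(x, ξ)` is kept because constraints active at `x₀` may become inactive at `x`. -/
noncomputable def linearisedResidual (f : Euc n → Euc r → ℝ) (g : Euc n → Euc r → Euc m)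
    (α ω : ℝ) (x₀ : Euc n) (μ₀ : Euc m) (ξ₀ : Euc r) (x : Euc n) (μ : Euc m) (ξ : Euc r) : ℝ :=
  ‖fderiv ℝ (gradient fun y => lagrangian f g y μ₀ ξ₀) x₀ (x - x₀)
      + (fderiv ℝ (fun y => g y ξ₀) x₀).adjoint (μ - μ₀)‖ / α
    + ‖activeDeriv g x₀ ξ₀ (x - x₀) - coordRestrict (g x₀ ξ₀ · = 0) (g x ξ)‖ / ω

theorem differentiable_gradient_lagrangian
    (hf : ContDiffOn ℝ 2 (fun p : Euc n × Euc r => f p.1 p.2) (univ ×ˢ Ξ))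
    (hg : ContDiffOn ℝ 2 (fun p : Euc n × Euc r => g p.1 p.2) (univ ×ˢ Ξ)) (hξ : ξ ∈ Ξ)
    (μ : Euc m) : Differentiable ℝ (gradient fun y => lagrangian f g y μ ξ) :=
  differentiable_slice_left (F := fun y ξ => gradient (fun z => lagrangian f g z μ ξ) y)
    ((contDiffOn_gradient_slice_left (contDiffOn_lagrangian hf hg μ)).differentiableOn one_ne_zero)
    hξ

theorem IsKKT.inner_adjoint_sub_nonneg (h₀ : IsKKT f g ξ₀ x₀ μ₀) (h : IsKKT f g ξ x μ)
    (hμ : ∀ i, g x₀ ξ₀ i ≠ 0 → μ i = 0) {d : Euc n}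
    (hd : activeDeriv g x₀ ξ₀ d =
      activeDeriv g x₀ ξ₀ (x - x₀) - coordRestrict (g x₀ ξ₀ · = 0) (g x ξ)) :
    0 ≤ ⟪(fderiv ℝ (fun y => g y ξ₀) x₀).adjoint (μ - μ₀), x - x₀ - d⟫_ℝ := by
  have hν (i : Fin m) (hi : g x₀ ξ₀ i ≠ 0) : (μ - μ₀) i = 0 := by
    simp [hμ i hi, h₀.eq_zero_of_apply_ne_zero hi]
  rw [← adjoint_activeDeriv_coordRestrict hν, ContinuousLinearMap.adjoint_inner_left,
    map_sub (activeDeriv g x₀ ξ₀), hd, sub_sub_cancel, inner_coordRestrict hν, inner_sub_left,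
    h.inner_eq_zero, zero_sub, neg_nonneg]
  exact inner_apply_nonpos_of_mem_feasible h₀.nonneg h.feasible

theorem IsKKT.norm_sub_le_linearisedResidual (h₀ : IsKKT f g ξ₀ x₀ μ₀) (h : IsKKT f g ξ x μ)
    (hμ : ∀ i, g x₀ ξ₀ i ≠ 0 → μ i = 0)
    (hω : 0 < ω) (hS : ∀ c, ω * ‖c‖ ≤ ‖(activeDeriv g x₀ ξ₀).adjoint c‖) (hα : 0 < α)
    (hL : StrongConvexOn univ α fun y => lagrangian f g y μ₀ ξ₀)
    (hd : Differentiable ℝ fun y => lagrangian f g y μ₀ ξ₀)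
    (hd₂ : DifferentiableAt ℝ (gradient fun y => lagrangian f g y μ₀ ξ₀) x₀)
    (hB : ‖fderiv ℝ (gradient fun y => lagrangian f g y μ₀ ξ₀) x₀‖ ≤ B) :
    ‖x - x₀‖ ≤ √(B / α) * linearisedResidual f g α ω x₀ μ₀ ξ₀ x μ ξ ∧
      ‖μ - μ₀‖ ≤ B / ω * (√(B / α) * linearisedResidual f g α ω x₀ μ₀ ξ₀ x μ ξ) := by
  obtain ⟨c, hc, hc_norm⟩ := exists_adjoint_apply_eq_and_norm_le hω hS
    (activeDeriv g x₀ ξ₀ (x - x₀) - coordRestrict (g x₀ ξ₀ · = 0) (g x ξ))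
  rw [ContinuousLinearMap.adjoint_adjoint] at hc
  have hgrad (y : Euc n) := (hd y).hasGradientAt
  have hB₀ : 0 ≤ B := (norm_nonneg _).trans hB
  obtain ⟨hx, hy⟩ := norm_le_of_variational hα (inner_hessian_left_eq_right hgrad hd₂.hasFDerivAt)
    (mul_norm_sq_le_inner_hessian hL hgrad hd₂.hasFDerivAt) hB rfl
    (h₀.inner_adjoint_sub_nonneg h hμ hc)
  refine ⟨hx.trans (by unfold linearisedResidual; gcongr), ?_⟩
  rw [div_mul_eq_mul_div, le_div_iff₀' hω]
  have hν (i : Fin m) (hi : g x₀ ξ₀ i ≠ 0) : (μ - μ₀) i = 0 := by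
    simp [hμ i hi, h₀.eq_zero_of_apply_ne_zero hi]
  exact (mul_norm_le_norm_adjoint_fderiv hS hν).trans
    (hy.trans (by unfold linearisedResidual; gcongr))

theorem exists_isLittleO_linearisedResidual_le (hΞ : UniqueDiffWithinAt ℝ Ξ ξ₀) (hξ₀ : ξ₀ ∈ Ξ)
    (hf : ContDiffOn ℝ 2 (fun p : Euc n × Euc r => f p.1 p.2) (univ ×ˢ Ξ))
    (hg : ContDiffOn ℝ 2 (fun p : Euc n × Euc r => g p.1 p.2) (univ ×ˢ Ξ))
    (hxs : ContinuousWithinAt xs Ξ ξ₀) (h : ∀ ξ ∈ Ξ, IsKKT f g ξ (xs ξ) (μs ξ))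
    (hα : 0 < α) (hω : 0 < ω) :
    ∃ e : Euc r → ℝ,
      e =o[𝓝[Ξ] ξ₀] (fun ξ => ‖xs ξ - xs ξ₀‖ + ‖μs ξ - μs ξ₀‖ + ‖ξ - ξ₀‖) ∧
      ∀ ξ, linearisedResidual f g α ω (xs ξ₀) (μs ξ₀) ξ₀ (xs ξ) (μs ξ) ξ ≤
        (‖mixedHessian f g Ξ (xs ξ₀) (μs ξ₀) ξ₀‖ / α
          + ‖activeParamDeriv g Ξ (xs ξ₀) ξ₀‖ / ω) * ‖ξ - ξ₀‖ + e ξ := by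
  have hstat := isLittleO_stationarity hΞ hξ₀ hf hg hxs h
  have hact := isLittleO_activeConstraints hΞ hξ₀ (hg.differentiableOn two_ne_zero) hxs
  have hΔ : (fun ξ => ‖xs ξ - xs ξ₀‖ + ‖ξ - ξ₀‖) =O[𝓝[Ξ] ξ₀]
      fun ξ => ‖xs ξ - xs ξ₀‖ + ‖μs ξ - μs ξ₀‖ + ‖ξ - ξ₀‖ := .of_norm_le fun ξ => by
    rw [Real.norm_of_nonneg (by positivity)]
    linarith [norm_nonneg (μs ξ - μs ξ₀)]
  refine ⟨_, (hstat.norm_left.const_mul_left α⁻¹).add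
    ((hact.trans_isBigO hΔ).norm_left.const_mul_left ω⁻¹), fun ξ => ?_⟩
  rw [linearisedResidual]
  set a := fderiv ℝ (gradient fun y => lagrangian f g y (μs ξ₀) ξ₀) (xs ξ₀) (xs ξ - xs ξ₀)
    + (fderiv ℝ (fun y => g y ξ₀) (xs ξ₀)).adjoint (μs ξ - μs ξ₀)
  set w := activeDeriv g (xs ξ₀) ξ₀ (xs ξ - xs ξ₀)
    - coordRestrict (g (xs ξ₀) ξ₀ · = 0) (g (xs ξ) ξ)
  set M := mixedHessian f g Ξ (xs ξ₀) (μs ξ₀) ξ₀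
  set N := activeParamDeriv g Ξ (xs ξ₀) ξ₀
  calc ‖a‖ / α + ‖w‖ / ω ≤ (‖M‖ * ‖ξ - ξ₀‖ + ‖a + M (ξ - ξ₀)‖) / α
        + (‖N‖ * ‖ξ - ξ₀‖ + ‖w + N (ξ - ξ₀)‖) / ω := by
        gcongr <;> exact norm_le_opNorm_mul_add_norm_add_apply ..
    _ = (‖M‖ / α + ‖N‖ / ω) * ‖ξ - ξ₀‖
        + (α⁻¹ * ‖a + M (ξ - ξ₀)‖ + ω⁻¹ * ‖w + N (ξ - ξ₀)‖) := by ring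

theorem eventually_norm_sub_le {K : ℝ} (hΞ : UniqueDiffWithinAt ℝ Ξ ξ₀) (hξ₀ : ξ₀ ∈ Ξ)
    (hf : ContDiffOn ℝ 2 (fun p : Euc n × Euc r => f p.1 p.2) (univ ×ˢ Ξ))
    (hg : ContDiffOn ℝ 2 (fun p : Euc n × Euc r => g p.1 p.2) (univ ×ˢ Ξ))
    (hxs : ContinuousWithinAt xs Ξ ξ₀) (h : ∀ ξ ∈ Ξ, IsKKT f g ξ (xs ξ) (μs ξ)) (hα : 0 < α)
    (hL : StrongConvexOn univ α fun y => lagrangian f g y (μs ξ₀) ξ₀)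
    (hB : ‖fderiv ℝ (gradient fun y => lagrangian f g y (μs ξ₀) ξ₀) (xs ξ₀)‖ ≤ B) (hω : 0 < ω)
    (hS : ∀ c, ω * ‖c‖ ≤ ‖(activeDeriv g (xs ξ₀) ξ₀).adjoint c‖)
    (hK : ‖mixedHessian f g Ξ (xs ξ₀) (μs ξ₀) ξ₀‖ / α
      + ‖activeParamDeriv g Ξ (xs ξ₀) ξ₀‖ / ω < K) :
    ∀ᶠ ξ in 𝓝[Ξ] ξ₀, ‖xs ξ - xs ξ₀‖ ≤ √(B / α) * (K * ‖ξ - ξ₀‖) ∧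
      ‖μs ξ - μs ξ₀‖ ≤ B / ω * (√(B / α) * (K * ‖ξ - ξ₀‖)) := by
  have hB₀ : 0 ≤ B := (norm_nonneg _).trans hB
  set T : Euc r → ℝ := fun ξ =>
    linearisedResidual f g α ω (xs ξ₀) (μs ξ₀) ξ₀ (xs ξ) (μs ξ) ξ
  have hstab : ∀ᶠ ξ in 𝓝[Ξ] ξ₀, ‖xs ξ - xs ξ₀‖ ≤ √(B / α) * T ξ ∧
      ‖μs ξ - μs ξ₀‖ ≤ B / ω * (√(B / α) * T ξ) := by
    filter_upwards [eventually_eq_zero_of_inactive hξ₀ hg.continuousOn hxs h,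
      self_mem_nhdsWithin] with ξ hμ hξ
    exact (h ξ₀ hξ₀).norm_sub_le_linearisedResidual (h ξ hξ) hμ hω hS hα hL
      (differentiable_slice_left
        ((contDiffOn_lagrangian hf hg _).differentiableOn two_ne_zero) hξ₀)
      (differentiable_gradient_lagrangian hf hg hξ₀ _ _) hB
  obtain ⟨e, he, hTe⟩ := exists_isLittleO_linearisedResidual_le hΞ hξ₀ hf hg hxs h hα hω
  have hT : ∀ᶠ ξ in 𝓝[Ξ] ξ₀, T ξ ≤ K * ‖ξ - ξ₀‖ :=
    eventually_le_of_le_add_isLittleO (C := √(B / α) + B / ω * √(B / α)) (by positivity)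
      (by positivity) (.of_forall fun _ => by positivity)
      (.of_forall hTe) (hstab.mono fun ξ hξ => by linarith [hξ.1, hξ.2]) he hK
  filter_upwards [hstab, hT] with ξ ⟨hx, hμ⟩ hT
  exact ⟨hx.trans (by gcongr), hμ.trans (by gcongr)⟩

theorem norm_sub_le_of_norm_mixedHessian_le {Lbar Gbar : ℝ} (hΞ : Convex ℝ Ξ)
    (hΞd : UniqueDiffOn ℝ Ξ)
    (hf : ContDiffOn ℝ 2 (fun p : Euc n × Euc r => f p.1 p.2) (univ ×ˢ Ξ))
    (hg : ContDiffOn ℝ 2 (fun p : Euc n × Euc r => g p.1 p.2) (univ ×ˢ Ξ))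
    (hxs : ContinuousOn xs Ξ) (h : ∀ ξ ∈ Ξ, IsKKT f g ξ (xs ξ) (μs ξ)) (hα : 0 < α)
    (hL : ∀ ξ ∈ Ξ, StrongConvexOn univ α fun y => lagrangian f g y (μs ξ) ξ)
    (hB : ∀ ξ ∈ Ξ, ‖fderiv ℝ (gradient fun y => lagrangian f g y (μs ξ) ξ) (xs ξ)‖ ≤ B)
    (hω : 0 < ω) (hS : ∀ ξ ∈ Ξ, ∀ c, ω * ‖c‖ ≤ ‖(activeDeriv g (xs ξ) ξ).adjoint c‖)
    (hM : ∀ ξ ∈ Ξ, ‖mixedHessian f g Ξ (xs ξ) (μs ξ) ξ‖ ≤ Lbar)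
    (hN : ∀ ξ ∈ Ξ, ‖activeParamDeriv g Ξ (xs ξ) ξ‖ ≤ Gbar)
    {ξ' : Euc r} (hξ : ξ ∈ Ξ) (hξ' : ξ' ∈ Ξ) :
    ‖xs ξ' - xs ξ‖ ≤ √(B / α) * (Lbar / α + Gbar / ω) * ‖ξ' - ξ‖ ∧
      ‖μs ξ' - μs ξ‖ ≤ B / ω * √(B / α) * (Lbar / α + Gbar / ω) * ‖ξ' - ξ‖ := by
  have hlocal : ∀ ξ₀ ∈ Ξ, ∀ K > Lbar / α + Gbar / ω, ∀ᶠ ξ in 𝓝[Ξ] ξ₀,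
      ‖xs ξ - xs ξ₀‖ ≤ √(B / α) * (K * ‖ξ - ξ₀‖) ∧
      ‖μs ξ - μs ξ₀‖ ≤ B / ω * (√(B / α) * (K * ‖ξ - ξ₀‖)) := fun ξ₀ hξ₀ K hK =>
    eventually_norm_sub_le (hΞd ξ₀ hξ₀) hξ₀ hf hg (hxs ξ₀ hξ₀) h hα (hL ξ₀ hξ₀) (hB ξ₀ hξ₀) hω
      (hS ξ₀ hξ₀) (lt_of_le_of_lt (by gcongr; exacts [hM ξ₀ hξ₀, hN ξ₀ hξ₀]) hK)
  constructor <;> refine norm_sub_le_of_forall_eventually_norm_sub_le hΞ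
    (fun ξ₀ hξ₀ C' hC' => ?_) hξ hξ' <;> obtain ⟨K, hK, hKC'⟩ := exists_gt_mul_le_of_mul_lt hC'
  · filter_upwards [hlocal ξ₀ hξ₀ K hK] with ξ hξ
    exact hξ.1.trans (by rw [← mul_assoc]; gcongr)
  · filter_upwards [hlocal ξ₀ hξ₀ K hK] with ξ hξ
    exact hξ.2.trans (by rw [← mul_assoc, ← mul_assoc]; gcongr)

theorem norm_fderiv_gradient_lagrangian_le {β : ℝ≥0} {l : Fin m → ℝ≥0} {ζ : Fin m → ℝ}
    (hfd : Differentiable ℝ fun y => f y ξ) (hgd : Differentiable ℝ fun y => g y ξ)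
    (hf : LipschitzWith β (gradient fun y => f y ξ))
    (hg : ∀ i, LipschitzWith (l i) (gradient fun y => g y ξ i))
    (hμ : ∀ i, 0 ≤ μ i) (hμζ : ∀ i, μ i ≤ ζ i) (x : Euc n) :
    ‖fderiv ℝ (gradient fun y => lagrangian f g y μ ξ) x‖ ≤ β + ∑ i, ζ i * l i :=
  norm_fderiv_le_of_lip' ℝ
    (add_nonneg β.2 (Finset.sum_nonneg fun i _ => mul_nonneg ((hμ i).trans (hμζ i)) (l i).2))
    (.of_forall fun y => norm_gradient_lagrangian_sub_le hfd hgd hf hg hμ hμζ y x)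

theorem exists_solutionMaps
    (hf : ContDiffOn ℝ 2 (fun p : Euc n × Euc r => f p.1 p.2) (univ ×ˢ Ξ))
    (hg : ContDiffOn ℝ 2 (fun p : Euc n × Euc r => g p.1 p.2) (univ ×ˢ Ξ))
    (hfeas : ∀ ξ ∈ Ξ, (feasible g ξ).Nonempty) (hα : 0 < α)
    (hfconv : ∀ ξ ∈ Ξ, StrongConvexOn univ α fun y => f y ξ)
    (hgconv : ∀ ξ ∈ Ξ, ∀ i, ConvexOn ℝ univ fun y => g y ξ i)
    (hω : 0 < ω) (hlicq : UniformLICQ g Ξ ω) :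
    ∃ (xs : Euc r → Euc n) (μs : Euc r → Euc m),
      (∀ ξ ∈ Ξ, primalSolutions f g ξ = {xs ξ}) ∧ (∀ ξ ∈ Ξ, dualSolutions f g ξ = {μs ξ}) ∧
      ∀ ξ ∈ Ξ, IsKKT f g ξ (xs ξ) (μs ξ) := by
  have hsol : ∀ ξ, ∃ (x : Euc n) (μ : Euc m), ξ ∈ Ξ →
      primalSolutions f g ξ = {x} ∧ dualSolutions f g ξ = {μ} ∧ IsKKT f g ξ x μ := by
    intro ξ
    by_cases hξ : ξ ∈ Ξ
    · have hfd := differentiable_slice_left (hf.differentiableOn two_ne_zero) hξ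
      have hgd := differentiable_slice_left (hg.differentiableOn two_ne_zero) hξ
      obtain ⟨x, hx⟩ := exists_primalSolutions_eq_singleton hα (hfconv ξ hξ) hfd (hgconv ξ hξ)
        hgd.continuous (hfeas ξ hξ)
      have hx_feas : x ∈ feasible g ξ := (hx.ge (mem_singleton x)).1
      obtain ⟨μ, hμ, h⟩ := exists_dualSolutions_eq_singleton hω
        (hlicq.mul_norm_le hξ hx_feas (hgd x)) hx (hfd x) (hgd x)
      exact ⟨x, μ, fun _ => ⟨hx, hμ, h⟩⟩
    · exact ⟨0, 0, fun h => absurd h hξ⟩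
  choose xs μs h using hsol
  exact ⟨xs, μs, fun ξ hξ => (h ξ hξ).1, fun ξ hξ => (h ξ hξ).2.1, fun ξ hξ => (h ξ hξ).2.2⟩

end Stability

end ParamProgram

open ParamProgram

theorem mainTheorem2 {n m r : ℕ}
    (Ξ : Set (Euc r)) (hΞ : Convex ℝ Ξ) (hΞi : (interior Ξ).Nonempty)
    (f : Euc n → Euc r → ℝ) (g : Euc n → Euc r → Euc m)
    (hf : ContDiffOn ℝ 2 (fun p : Euc n × Euc r => f p.1 p.2) (univ ×ˢ Ξ))
    (hg : ContDiffOn ℝ 2 (fun p : Euc n × Euc r => g p.1 p.2) (univ ×ˢ Ξ))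
    -- feasibility
    (hfeas : ∀ ξ ∈ Ξ, (ParamProgram.feasible g ξ).Nonempty)
    -- convexity and smoothness in `x`
    (α : ℝ) (hα : 0 < α) (β : ℝ≥0) (l : Fin m → ℝ≥0)
    (hfconv : ∀ ξ ∈ Ξ, StrongConvexOn univ α (fun x => f x ξ))
    (hfLip : ∀ ξ ∈ Ξ, LipschitzWith β (gradient fun x => f x ξ))
    (hgconv : ∀ ξ ∈ Ξ, ∀ i, ConvexOn ℝ univ (fun x => g x ξ i))
    (hgLip : ∀ ξ ∈ Ξ, ∀ i, LipschitzWith (l i) (gradient fun x => g x ξ i))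
    -- uniform LICQ
    (ω : ℝ) (hω : 0 < ω) (hlicq : ParamProgram.UniformLICQ g Ξ ω)
    -- bounded multipliers
    (ζ : Fin m → ℝ) (hζ : ∀ i, 0 < ζ i)
    (hdual : ∀ ξ ∈ Ξ, ∀ x μ, ParamProgram.IsKKT f g ξ x μ → ∀ i, μ i ≤ ζ i) :
    ∃ (xs : Euc r → Euc n) (μs : Euc r → Euc m),
      (∀ ξ ∈ Ξ, ParamProgram.primalSolutions f g ξ = {xs ξ}) ∧
      (∀ ξ ∈ Ξ, ParamProgram.dualSolutions f g ξ = {μs ξ}) ∧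
      ∀ Lbar Gbar : ℝ,
        IsLUB ((fun ξ => ‖ParamProgram.mixedHessian f g Ξ (xs ξ) (μs ξ) ξ‖) '' Ξ) Lbar →
        IsLUB ((fun ξ => ‖ParamProgram.activeParamDeriv g Ξ (xs ξ) ξ‖) '' Ξ) Gbar →
        (∀ ξ ∈ Ξ, ∀ ξ' ∈ Ξ, ‖xs ξ' - xs ξ‖ ≤
          (Real.sqrt ((β + ∑ i, ζ i * l i) / α) * (Lbar / α + Gbar / ω)) * ‖ξ' - ξ‖) ∧
        (∀ ξ ∈ Ξ, ∀ ξ' ∈ Ξ, ‖μs ξ' - μs ξ‖ ≤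
          ((β + ∑ i, ζ i * l i) ^ (3 / 2 : ℝ) / (α ^ (1 / 2 : ℝ) * ω)
            * (Lbar / α + Gbar / ω)) * ‖ξ' - ξ‖) := by
  obtain ⟨xs, μs, hx, hμ, h⟩ := exists_solutionMaps hf hg hfeas hα hfconv hgconv hω hlicq
  refine ⟨xs, μs, hx, hμ, fun Lbar Gbar hM hN => ?_⟩
  have hfd {ξ} (hξ : ξ ∈ Ξ) := differentiable_slice_left (hf.differentiableOn two_ne_zero) hξ
  have hgd {ξ} (hξ : ξ ∈ Ξ) := differentiable_slice_left (hg.differentiableOn two_ne_zero) hξ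
  have hμζ : ∀ ξ ∈ Ξ, ∀ i, μs ξ i ≤ ζ i := fun ξ hξ => hdual ξ hξ _ _ (h ξ hξ)
  have hμ_norm : ∀ ξ ∈ Ξ, ‖μs ξ‖ ≤ ‖(WithLp.toLp 2 ζ : Euc m)‖ := fun ξ hξ =>
    norm_le_norm_of_forall_apply_le (h ξ hξ).nonneg (hμζ ξ hξ)
  have hLipschitz {ξ ξ' : Euc r} (hξ : ξ ∈ Ξ) (hξ' : ξ' ∈ Ξ) :=
    norm_sub_le_of_norm_mixedHessian_le hΞ (uniqueDiffOn_convex hΞ hΞi) hf hg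
      (continuousOn_primal hα hf hg hfconv hgconv h hμ_norm) h hα
      (fun ξ hξ => strongConvexOn_lagrangian (hfconv ξ hξ) (hgconv ξ hξ) (h ξ hξ).nonneg)
      (fun ξ hξ => norm_fderiv_gradient_lagrangian_le (hfd hξ) (hgd hξ) (hfLip ξ hξ)
        (hgLip ξ hξ) (h ξ hξ).nonneg (hμζ ξ hξ) _)
      hω (fun ξ hξ => hlicq.mul_norm_le hξ (h ξ hξ).feasible (hgd hξ _))
      (fun ξ hξ => hM.1 (mem_image_of_mem _ hξ)) (fun ξ hξ => hN.1 (mem_image_of_mem _ hξ)) hξ hξ'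
  have hB : (0 : ℝ) ≤ β + ∑ i, ζ i * l i :=
    add_nonneg β.2 (Finset.sum_nonneg fun i _ => mul_nonneg (hζ i).le (l i).2)
  rw [rpow_three_halves_div hB]
  exact ⟨fun ξ hξ ξ' hξ' => (hLipschitz hξ hξ').1, fun ξ hξ ξ' hξ' => (hLipschitz hξ hξ').2⟩
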